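/- Let $V$ be a complex vector space of finite dimension $r$. A reflection of $V$ is an element of $\mathrm{GL}(V)$ that fixes some hyperplane pointwise; a complex reflection group on $V$ is a finite subgroup of $\mathrm{GL}(V)$ that is generated by reflections. Let $\mathrm{GL}(V)$ act on the algebra $S(V^*)$ of polynomial functions on $V$ by $(gf)(v)=f(g^{-1}v)$. Theorem. Let $G\subset\mathrm{GL}(V)$ be a complex reflection group, and let $N$ be a normal subgroup of $G$ that is generated by reflections. Then the quotient group $H=G/N$ acts as a complex reflection group on the vector space $E=V/N$. Precisely, there exist homogeneous, algebraically independent polynomials $N_1,\dots,N_r\in S(V^*)^N$ with $S(V^*)^N=\mathbb{C}[N_1,\dots,N_r]$ such that the linear span $E^*=\mathrm{span}_{\mathbb{C}}\{N_1,\dots,N_r\}$ is $G$-stable and, with $E:=\mathrm{Hom}_{\mathbb{C}}(E^*,\mathbb{C})$ the dual vector space of $E^*$: 1. the action $(gN)f:=gf$ of $H$ on $E^*$ is well defined, and the dual representation $\rho\colon H\to\mathrm{GL}(E)$, given by $(\rho(gN)e)(gf)=e(f)$ for $g\in G$, $e\in E$, $f\in E^*$, is injective, and its image is a complex reflection group on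 $E$; 2. the map $V\to E$, $v\mapsto(f\mapsto f(v))$, induces a bijection from the orbit space $V/N$ onto $E$, which is $H$-equivariant for the action $gN\cdot Nv=N(gv)$ of $H$ on $V/N$. -/

import Mathlib

namespace ReflQuot

open Module

variable {V : Type*} [AddCommGroup V] [Module ℂ V]

/-- A reflection: an invertible linear map that fixes some hyperplane (a maximal proper subspace)
pointwise. As in the usual convenient convention, the identity is not excluded; this does not affect
which groups are generated by reflections. -/
def IsReflection (g : LinearMap.GeneralLinearGroup ℂ V) : Prop :=
  ∃ W : Submodule ℂ V, IsCoatom W ∧ ∀ v ∈ W, g • v = v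

/-- The group `Γ` is generated by reflections (namely, by the reflections that it contains). -/
def IsGeneratedByReflections (Γ : Subgroup (LinearMap.GeneralLinearGroup ℂ V)) : Prop :=
  Subgroup.closure {g | g ∈ Γ ∧ IsReflection g} = Γ

/-- A complex reflection group: a finite subgroup of `GL(V)` generated by reflections. -/
def IsComplexReflectionGroup (Γ : Subgroup (LinearMap.GeneralLinearGroup ℂ V)) : Prop :=
  Finite Γ ∧ IsGeneratedByReflections Γ

variable (V) in
/-- The algebra `S(V*)` of polynomial functions on `V`. -/
abbrev PolyFun : Type _ := SymmetricAlgebra ℂ (Dual ℂ V)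

/-- The value at `v` of a polynomial function: the algebra map `S(V*) → ℂ` that sends `φ ∈ V*`
to `φ v`. -/
noncomputable def evalAt (v : V) : PolyFun V →ₐ[ℂ] ℂ :=
  SymmetricAlgebra.lift (Dual.eval ℂ V v)

/-- The action of `g ∈ GL(V)` on `S(V*)`: the algebra map that sends `φ ∈ V*` to `φ ∘ g⁻¹`. -/
noncomputable def act (g : LinearMap.GeneralLinearGroup ℂ V) : PolyFun V →ₐ[ℂ] PolyFun V :=
  SymmetricAlgebra.lift
    (SymmetricAlgebra.ι ℂ (Dual ℂ V) ∘ₗ LinearMap.dualMap (↑g⁻¹ : V →ₗ[ℂ] V))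

/-- The ring `S(V*)^Γ` of `Γ`-invariant polynomial functions. -/
noncomputable def invariants (Γ : Subgroup (LinearMap.GeneralLinearGroup ℂ V)) :
    Subalgebra ℂ (PolyFun V) :=
  ⨅ g ∈ Γ, AlgHom.equalizer (act g) (AlgHom.id ℂ (PolyFun V))

/-- The polynomial function `f` is homogeneous of degree `d`, that is, a sum of products of `d`
linear forms. -/
def IsHomogeneousOfDegree (f : PolyFun V) (d : ℕ) : Prop :=
  f ∈ LinearMap.range (SymmetricAlgebra.ι ℂ (Dual ℂ V)) ^ d

/-- A system of fundamental `Γ`-invariants: `r = dim V` homogeneous algebraically independent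
polynomials that generate the algebra `S(V*)^Γ`. -/
structure IsFundamentalInvariants (Γ : Subgroup (LinearMap.GeneralLinearGroup ℂ V))
    (n : Fin (finrank ℂ V) → PolyFun V) : Prop where
  homogeneous : ∀ i, ∃ d : ℕ, IsHomogeneousOfDegree (n i) d
  algebraicIndependent : AlgebraicIndependent ℂ n
  generate : Algebra.adjoin ℂ (Set.range n) = invariants Γ

/-- The linear span `E* ⊆ S(V*)` of a family of polynomial functions. -/
abbrev spanOf {ι : Type*} (n : ι → PolyFun V) : Submodule ℂ (PolyFun V) :=
  Submodule.span ℂ (Set.range n)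

end ReflQuot

/-!
The heart of the matter is a form of Chevalley's theorem in which the generators of the ring of
invariants of `N` span a `G`-stable space `E*`; the assertions about `E` then follow by
commutative algebra.

*Invariants of `N`.* Let `S` be the polynomial ring, `R = S^N`, and `I` the ideal of `S` generated
by the invariants without constant term. A reflection `s` with hyperplane `α = 0` has a divided
difference `p ↦ (s p - p) / α`, which is `R`-linear and lowers degrees by one. By induction on the
degree, a homogeneous `p` with `h p ∈ J S`, where `J` is an ideal of `R` and `h ∈ R` is not in `J`,
is invariant modulo `I`, hence lies in `I`
(`ReflQuot.ActsLinearly.mem_hilbertIdeal_of_smul_mem`).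

Let `M ⊆ R` be the space of decomposable invariants, spanned by the products of two invariants
without constant term, and let `n i` be homogeneous invariants of positive degrees, linearly
independent modulo `M`. A nontrivial relation `∑ h i * ∂ₖ (n i) = 0` over `R` would, by the result
above, put all the partial derivatives of some nontrivial linear combination `f` of the `n i` into
`I`; Euler's identity and averaging over `N` then give `f ∈ M`, a contradiction. Hence
the differentials of the `n i` are independent over `R`, and the chain rule makes the `n i`
algebraically independent (`ReflQuot.IsIndecomposableFamily.algebraicIndependent`). In each degree,
Maschke's theorem provides a `G`-stable complement of the decomposable invariants among the
invariants. A homogeneous basis of the sum of these complements generates `R`, and it has `dim V`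
members by comparison of transcendence degrees (`ReflQuot.exists_stable_fundamental_invariants`).

*The orbit space.* Evaluation maps `V` to `E`. Its fibres are the orbits of `N` because a finite
group permutes transitively the primes of `S` over a given prime of `R`, and it is surjective
because a character of `R` extends to `S`, which is integral over `R`, and characters of `S` are
evaluations by the Nullstellensatz.

*The group `G / N` on `E`.* If `g` acts trivially on `E`, then `g v ∈ N v` for all `v`, so `V` is
the union of the finitely many subspaces `ker (g - x)` with `x ∈ N`, and `g ∈ N`. If `g` is a
reflection with hyperplane `W`, its fixed space in `E` contains the image of `W`, so it has
dimension at least `dim W`: otherwise the restrictions of `R` to `W` would be generated by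
fewer than `dim W` elements, although `S(W*)` is integral over them
(`ReflQuot.finrank_le_of_evalSpan_mem`). Hence reflections of `G` act on `E` as reflections.
-/


/-! ### Polynomials and invariants of a linear group action -/

namespace ReflQuot

open MvPolynomial

section Polynomials

variable {σ K ι : Type*} [Field K]

lemma homogeneousComponent_mul_of_isHomogeneous {q : MvPolynomial σ K} {e : ℕ}
    (hq : q.IsHomogeneous e) (f : MvPolynomial σ K) (D : ℕ) :
    homogeneousComponent D (f * q) =
      if e ≤ D then homogeneousComponent (D - e) f * q else 0 := by
  conv_lhs => rw [← sum_homogeneousComponent f, Finset.sum_mul, map_sum]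
  simp_rw [fun i => homogeneousComponent_of_mem (m := D)
    ((homogeneousComponent_isHomogeneous i f).mul hq)]
  split_ifs with hle
  · have h2 : ∀ i, (D = i + e) ↔ (i = D - e) := fun i => by omega
    simp_rw [h2]
    rw [Finset.sum_ite_eq']
    split_ifs with hd
    · rfl
    · rw [homogeneousComponent_eq_zero _ _ (by rw [Finset.mem_range] at hd; omega), zero_mul]
  · exact Finset.sum_eq_zero fun i _ => if_neg (by omega)

lemma coeff_mul_of_isHomogeneous {a f : MvPolynomial σ K} {e : ℕ} (hf : f.IsHomogeneous e)
    {m : σ →₀ ℕ} (hm : m.degree ≤ e) : coeff m (a * f) = coeff 0 a * coeff m f := by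
  classical
  rw [coeff_mul]
  apply Finset.sum_eq_single (0, m)
  · rintro ⟨u, v⟩ huv hne
    replace huv : u + v = m := Finset.HasAntidiagonal.mem_antidiagonal.1 huv
    by_cases hv : v.degree = e
    · exfalso
      apply hne
      have h1 : u.degree + v.degree = m.degree := by rw [← huv, map_add]
      have h2 : u = 0 := by
        rw [← Finsupp.degree_eq_zero_iff]
        omega
      subst h2
      simpa using huv
    · dsimp only
      rw [hf.coeff_eq_zero hv, mul_zero]
  · intro h
    simp at h

/-- The chain rule for polynomials. -/
lemma pderiv_aeval [Fintype ι] (n : ι → MvPolynomial σ K) (P : MvPolynomial ι K) (k : σ) :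
    pderiv k (aeval n P) = ∑ i, aeval n (pderiv i P) * pderiv k (n i) := by
  classical
  induction P using MvPolynomial.induction_on with
  | C a => simp
  | add p q hp hq =>
    rw [map_add, map_add, hp, hq, ← Finset.sum_add_distrib]
    exact Finset.sum_congr rfl fun i _ => by rw [map_add, map_add, add_mul]
  | mul_X p j hp =>
    rw [map_mul, aeval_X, pderiv_mul, hp, Finset.sum_mul]
    simp_rw [pderiv_mul, map_add, map_mul, aeval_X, add_mul]
    rw [Finset.sum_add_distrib]
    congr 1
    · exact Finset.sum_congr rfl fun i _ => by ring
    · rw [Finset.sum_eq_single j]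
      · simp
      · intro i _ hij
        simp [pderiv_X_of_ne hij.symm]
      · simp

lemma totalDegree_pderiv_lt {P : MvPolynomial ι K} (i : ι) (h : pderiv i P ≠ 0) :
    (pderiv i P).totalDegree < P.totalDegree := by
  classical
  rw [totalDegree, Finset.sup_lt_iff]
  · intro m hm
    rw [mem_support_iff, coeff_pderiv] at hm
    have h1 : m + Finsupp.single i 1 ∈ P.support := by
      rw [mem_support_iff]
      exact left_ne_zero_of_mul hm
    have h2 := le_totalDegree h1
    rw [Finsupp.sum_add_index' (by simp) (by simp)] at h2
    simp at h2
    omega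
  · rw [bot_eq_zero, Nat.pos_iff_ne_zero]
    intro h0
    rw [totalDegree_eq_zero_iff_eq_C.1 h0, pderiv_C] at h
    exact h rfl

lemma eq_C_of_pderiv_eq_zero [CharZero K] {P : MvPolynomial ι K} (h : ∀ i, pderiv i P = 0) :
    P = C (coeff 0 P) := by
  classical
  ext m
  rw [coeff_C]
  split_ifs with hm
  · rw [hm]
  · obtain ⟨i, hi⟩ := Finsupp.ne_iff.1 (Ne.symm hm)
    have h1 : m - Finsupp.single i 1 + Finsupp.single i 1 = m :=
      tsub_add_cancel_of_le (by simpa [Nat.one_le_iff_ne_zero] using hi)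
    have h2 := coeff_pderiv (i := i) P (m - Finsupp.single i 1)
    rw [h i, coeff_zero, h1, eq_comm, mul_eq_zero] at h2
    refine h2.resolve_right ?_
    exact Nat.cast_add_one_ne_zero _

end Polynomials

section PolynomialInvariants

variable {σ K Γ : Type*} [Field K] [Group Γ] [MulSemiringAction Γ (MvPolynomial σ K)]
  [SMulCommClass Γ K (MvPolynomial σ K)]

variable (σ K Γ) in
/-- The algebra of polynomials fixed by `Γ`. -/
noncomputable abbrev PolyInv : Subalgebra K (MvPolynomial σ K) :=
  FixedPoints.subalgebra K (MvPolynomial σ K) Γ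

variable (σ K Γ) in
/-- The group `Γ` acts on polynomials by linear substitutions: it maps variables to linear forms.
-/
def ActsLinearly : Prop := ∀ (g : Γ) (i : σ), (g • (X i : MvPolynomial σ K)).IsHomogeneous 1

lemma smul_C_eq (g : Γ) (c : K) :
    g • (C c : MvPolynomial σ K) = C c :=
  smul_algebraMap g c

lemma ActsLinearly.smul_isHomogeneous (hlin : ActsLinearly σ K Γ) (g : Γ)
    {f : MvPolynomial σ K} {d : ℕ} (hf : f.IsHomogeneous d) : (g • f).IsHomogeneous d := by
  have h : MulSemiringAction.toAlgHom K (MvPolynomial σ K) g = aeval fun i => g • X i :=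
    algHom_ext fun i => by simp
  have h2 := hf.aeval (fun i => g • (X i : MvPolynomial σ K)) (hlin g)
  rw [← h, one_mul] at h2
  exact h2

lemma ActsLinearly.homogeneousComponent_smul (hlin : ActsLinearly σ K Γ) (g : Γ)
    (f : MvPolynomial σ K) (d : ℕ) :
    homogeneousComponent d (g • f) = g • homogeneousComponent d f := by
  conv_lhs => rw [← sum_homogeneousComponent f, Finset.smul_sum, map_sum]
  have h : ∀ i, homogeneousComponent d (g • homogeneousComponent i f) =
      if i = d then g • homogeneousComponent d f else 0 := by
    intro i
    rw [homogeneousComponent_of_mem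
      (hlin.smul_isHomogeneous g (homogeneousComponent_isHomogeneous i f))]
    by_cases hi : i = d
    · simp [hi]
    · simp [hi, Ne.symm hi]
  simp_rw [h]
  rw [Finset.sum_ite_eq']
  split_ifs with hd
  · rfl
  · rw [homogeneousComponent_eq_zero _ _ (by simpa using hd), smul_zero]

lemma ActsLinearly.constantCoeff_smul (hlin : ActsLinearly σ K Γ) (g : Γ)
    (f : MvPolynomial σ K) : constantCoeff (g • f) = constantCoeff f := by
  have h := hlin.homogeneousComponent_smul g f 0
  rw [homogeneousComponent_zero, homogeneousComponent_zero, smul_C_eq] at h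
  exact C_injective _ _ h

lemma ActsLinearly.homogeneousComponent_mem (hlin : ActsLinearly σ K Γ)
    {f : MvPolynomial σ K} (hf : f ∈ PolyInv σ K Γ) (d : ℕ) :
    homogeneousComponent d f ∈ PolyInv σ K Γ := fun g => by
  rw [← hlin.homogeneousComponent_smul, hf g]

section Reynolds

variable [Fintype Γ]

/-- The Reynolds operator: averaging over `Γ`, as a linear map over the invariants. -/
noncomputable def reynolds : MvPolynomial σ K →ₗ[PolyInv σ K Γ] PolyInv σ K Γ where
  toFun f := ⟨(Fintype.card Γ : K)⁻¹ • ∑ g : Γ, g • f, fun g => by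
    rw [smul_comm, Finset.smul_sum]
    congr 1
    simp_rw [smul_smul]
    exact Fintype.sum_equiv (Equiv.mulLeft g) _ _ fun _ => rfl⟩
  map_add' f f' := Subtype.ext <| by simp [Finset.sum_add_distrib]
  map_smul' r f := Subtype.ext <| by
    have h : ∀ g : Γ, g • (r : MvPolynomial σ K) = r := r.2
    simp [Algebra.smul_def, Finset.mul_sum, h, mul_left_comm]

lemma coe_reynolds (f : MvPolynomial σ K) :
    (reynolds (Γ := Γ) f : MvPolynomial σ K) = (Fintype.card Γ : K)⁻¹ • ∑ g : Γ, g • f := rfl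

lemma reynolds_coe [CharZero K] (r : PolyInv σ K Γ) :
    reynolds (r : MvPolynomial σ K) = r := by
  apply Subtype.ext
  have h : ∀ g : Γ, g • (r : MvPolynomial σ K) = r := r.2
  rw [coe_reynolds]
  simp_rw [h]
  rw [Finset.sum_const, Finset.card_univ, ← Nat.cast_smul_eq_nsmul K, smul_smul,
    inv_mul_cancel₀ (by simp), one_smul]

lemma reynolds_algebraMap_mul (f : MvPolynomial σ K) (r : PolyInv σ K Γ) :
    reynolds ((r : MvPolynomial σ K) * f) = r * reynolds f :=
  (reynolds (Γ := Γ)).map_smul r f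

lemma ActsLinearly.reynolds_isHomogeneous (hlin : ActsLinearly σ K Γ) {f : MvPolynomial σ K}
    {d : ℕ} (hf : f.IsHomogeneous d) :
    (reynolds (Γ := Γ) f : MvPolynomial σ K).IsHomogeneous d := by
  rw [coe_reynolds]
  exact (homogeneousSubmodule σ K d).smul_mem _
    (IsHomogeneous.sum _ _ _ fun g _ => hlin.smul_isHomogeneous g hf)

lemma ActsLinearly.constantCoeff_reynolds (hlin : ActsLinearly σ K Γ) {f : MvPolynomial σ K}
    (hf : constantCoeff f = 0) :
    constantCoeff (reynolds (Γ := Γ) f : MvPolynomial σ K) = 0 := by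
  rw [coe_reynolds, ← C_mul', map_mul, map_sum]
  simp [hlin.constantCoeff_smul, hf]

/-- An ideal of the ring of invariants is the contraction of its extension. -/
lemma mem_of_coe_mem_smul_top [CharZero K] (J : Ideal (PolyInv σ K Γ)) (r : PolyInv σ K Γ)
    (h : (r : MvPolynomial σ K) ∈ (J • ⊤ : Submodule (PolyInv σ K Γ) (MvPolynomial σ K))) :
    r ∈ J := by
  have h2 := Submodule.smul_top_le_comap_smul_top J (reynolds (σ := σ) (K := K) (Γ := Γ)) h
  rw [Submodule.mem_comap, reynolds_coe] at h2
  simpa using h2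

end Reynolds

/-- The group element `s` moves every polynomial by a multiple of the nonzero linear form `α`:
the action of a reflection with reflecting hyperplane `α = 0`. -/
def MovesAlong (s : Γ) (α : MvPolynomial σ K) : Prop :=
  α ≠ 0 ∧ α.IsHomogeneous 1 ∧ ∀ p : MvPolynomial σ K, α ∣ s • p - p

/-- The divided difference `p ↦ (s p - p) / α` of a reflection `s`, as a linear map over the
invariants. -/
noncomputable def MovesAlong.dividedDifference {s : Γ} {α : MvPolynomial σ K}
    (h : MovesAlong s α) : MvPolynomial σ K →ₗ[PolyInv σ K Γ] MvPolynomial σ K where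
  toFun p := (h.2.2 p).choose
  map_add' p q := by
    apply mul_left_cancel₀ h.1
    rw [mul_add, ← (h.2.2 p).choose_spec, ← (h.2.2 q).choose_spec,
      ← (h.2.2 (p + q)).choose_spec, smul_add]
    ring
  map_smul' r p := by
    have hr : s • (r : MvPolynomial σ K) = r := r.2 s
    apply mul_left_cancel₀ h.1
    rw [RingHom.id_apply, mul_smul_comm, ← (h.2.2 p).choose_spec,
      ← (h.2.2 (r • p)).choose_spec, Algebra.smul_def, Algebra.smul_def, smul_mul']
    change s • (r : MvPolynomial σ K) * _ - _ = (r : MvPolynomial σ K) * _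
    rw [hr, mul_sub]
    rfl

lemma MovesAlong.mul_dividedDifference {s : Γ} {α : MvPolynomial σ K}
    (h : MovesAlong s α) (p : MvPolynomial σ K) : α * h.dividedDifference p = s • p - p :=
  (h.2.2 p).choose_spec.symm

lemma isHomogeneous_of_mul_isHomogeneous {α q : MvPolynomial σ K} {d : ℕ} (hα : α ≠ 0)
    (hα1 : α.IsHomogeneous 1) (h : (α * q).IsHomogeneous (d + 1)) : q.IsHomogeneous d := by
  have key : α * q = α * homogeneousComponent d q := by
    rw [mul_comm] at h ⊢
    rw [← homogeneousComponent_eq_self h, homogeneousComponent_mul_of_isHomogeneous hα1,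
      if_pos (by omega), mul_comm, Nat.add_sub_cancel]
  rw [mul_left_cancel₀ hα key]
  exact homogeneousComponent_isHomogeneous d q

variable (σ K Γ) in
/-- The Hilbert ideal: generated by the invariants without constant term. -/
noncomputable def hilbertIdeal : Ideal (MvPolynomial σ K) :=
  Ideal.span {f | f ∈ PolyInv σ K Γ ∧ constantCoeff f = 0}

lemma smul_mem_hilbertIdeal (g : Γ)
    {f : MvPolynomial σ K} (hf : f ∈ hilbertIdeal σ K Γ) : g • f ∈ hilbertIdeal σ K Γ := by
  refine Submodule.span_induction ?_ ?_ ?_ ?_ hf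
  · intro x hx
    rw [hx.1 g]
    exact Ideal.subset_span hx
  · simp
  · intro x y _ _ hx hy
    rw [smul_add]
    exact add_mem hx hy
  · intro a x _ hx
    rw [smul_eq_mul, smul_mul']
    exact Ideal.mul_mem_left _ _ hx

/-- The key lemma on reflection groups: if an invariant `h` outside an ideal `J` of the invariants
satisfies `h p ∈ J S` with `p` homogeneous, then `p` lies in the Hilbert ideal. By induction on
the degree, divided differences show that `p` is invariant modulo the Hilbert ideal. -/
theorem ActsLinearly.mem_hilbertIdeal_of_smul_mem [Fintype Γ] [CharZero K]
    (hlin : ActsLinearly σ K Γ)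
    (hrefl : Subgroup.closure {s : Γ | ∃ α : MvPolynomial σ K, MovesAlong s α} = ⊤)
    (J : Ideal (PolyInv σ K Γ)) (h : PolyInv σ K Γ) (hJ : h ∉ J) {d : ℕ} {p : MvPolynomial σ K}
    (hp : p.IsHomogeneous d)
    (hhp : h • p ∈ (J • ⊤ : Submodule (PolyInv σ K Γ) (MvPolynomial σ K))) :
    p ∈ hilbertIdeal σ K Γ := by
  induction d generalizing p with
  | zero =>
    rw [← totalDegree_zero_iff_isHomogeneous, totalDegree_eq_zero_iff_eq_C] at hp
    set c := coeff 0 p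
    -- A nonzero constant `p` would put `h` into `J S ∩ R = J`.
    by_cases hc : c = 0
    · rw [hp, hc, C_0]
      exact zero_mem _
    · refine absurd (mem_of_coe_mem_smul_top J h ?_) hJ
      have h1 := Submodule.smul_mem _ (algebraMap K (PolyInv σ K Γ) c⁻¹) hhp
      have h2 : algebraMap K (PolyInv σ K Γ) c⁻¹ • h • p = (h : MvPolynomial σ K) := by
        rw [hp, Algebra.smul_def, Algebra.smul_def]
        change C c⁻¹ * ((h : MvPolynomial σ K) * C c) = (h : MvPolynomial σ K)
        rw [mul_left_comm, ← C_mul, inv_mul_cancel₀ hc, C_1, mul_one]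
      rwa [h2] at h1
  | succ d ih =>
    have hmem : ∀ g : Γ, g • p - p ∈ hilbertIdeal σ K Γ := by
      intro g
      have hg : g ∈ Subgroup.closure {s : Γ | ∃ α : MvPolynomial σ K, MovesAlong s α} := by
        rw [hrefl]; trivial
      induction hg using Subgroup.closure_induction with
      | mem s hs =>
        obtain ⟨α, hα⟩ := hs
        rw [← hα.mul_dividedDifference]
        refine Ideal.mul_mem_left _ _ (ih ?_ ?_)
        · apply isHomogeneous_of_mul_isHomogeneous hα.1 hα.2.1
          rw [hα.mul_dividedDifference]
          exact (hlin.smul_isHomogeneous s hp).sub hp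
        · rw [← map_smul]
          exact Submodule.smul_top_le_comap_smul_top J hα.dividedDifference hhp
      | one => simp
      | mul a b _ _ ha hb =>
        have : (a * b) • p - p = a • (b • p - p) + (a • p - p) := by
          rw [smul_sub, smul_smul]; abel
        rw [this]
        exact add_mem (smul_mem_hilbertIdeal a hb) ha
      | inv a _ ha =>
        have : a⁻¹ • p - p = -(a⁻¹ • (a • p - p)) := by
          rw [smul_sub, inv_smul_smul]; abel
        rw [this]
        exact neg_mem (smul_mem_hilbertIdeal a⁻¹ ha)
    -- Modulo the Hilbert ideal, `p` equals its average, an invariant of positive degree.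
    have h1 : (reynolds (Γ := Γ) p : MvPolynomial σ K) ∈ hilbertIdeal σ K Γ := by
      refine Ideal.subset_span ⟨(reynolds (Γ := Γ) p).2, ?_⟩
      rw [constantCoeff_eq]
      exact (hlin.reynolds_isHomogeneous hp).coeff_eq_zero (d := 0) (by simp)
    have h2 : p = (reynolds (Γ := Γ) p : MvPolynomial σ K) -
        C (Fintype.card Γ : K)⁻¹ * ∑ g : Γ, (g • p - p) := by
      rw [coe_reynolds, C_mul', Finset.sum_sub_distrib, smul_sub, Finset.sum_const,
        Finset.card_univ, ← Nat.cast_smul_eq_nsmul K, smul_smul, inv_mul_cancel₀ (by simp),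
        one_smul]
      abel
    rw [h2]
    exact sub_mem h1 (Ideal.mul_mem_left _ _ (sum_mem fun g _ => hmem g))

end PolynomialInvariants

end ReflQuot

/-! ### Algebraic independence of indecomposable invariants -/

namespace ReflQuot

open MvPolynomial

section AlgebraicIndependence

variable {σ K Γ : Type*} [Field K] [Group Γ] [MulSemiringAction Γ (MvPolynomial σ K)]
  [SMulCommClass Γ K (MvPolynomial σ K)]

variable (σ K Γ) in
/-- The space of invariants without constant term. -/
noncomputable def posInv : Submodule K (MvPolynomial σ K) :=
  Subalgebra.toSubmodule (PolyInv σ K Γ) ⊓ LinearMap.ker (lcoeff K (0 : σ →₀ ℕ))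

lemma mem_posInv {f : MvPolynomial σ K} :
    f ∈ posInv σ K Γ ↔ f ∈ PolyInv σ K Γ ∧ constantCoeff f = 0 := Iff.rfl

variable (σ K Γ) in
/-- The space of decomposable invariants: sums of products of two invariants without constant
term. -/
noncomputable def decomposables : Submodule K (MvPolynomial σ K) :=
  posInv σ K Γ * posInv σ K Γ

lemma ActsLinearly.reynolds_mul_mem_decomposables [Fintype Γ] (hlin : ActsLinearly σ K Γ)
    {a x : MvPolynomial σ K} (ha : constantCoeff a = 0) (hx : x ∈ hilbertIdeal σ K Γ) :
    (reynolds (Γ := Γ) (a * x) : MvPolynomial σ K) ∈ decomposables σ K Γ := by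
  induction hx using Submodule.span_induction generalizing a with
  | mem f hf =>
    have h : reynolds (Γ := Γ) (a * f) = ⟨f, hf.1⟩ * reynolds a := by
      rw [← reynolds_algebraMap_mul, mul_comm]
    rw [h]
    exact Submodule.mul_mem_mul hf ⟨(reynolds a).2, hlin.constantCoeff_reynolds ha⟩
  | zero => simp
  | add x y _ _ hx hy =>
    rw [mul_add, map_add]
    exact add_mem (hx ha) (hy ha)
  | smul b x _ hx =>
    rw [smul_eq_mul, ← mul_assoc]
    exact hx (by rw [map_mul, ha, zero_mul])

variable {ι : Type*}

/-- The family `n` consists of homogeneous invariants of positive degrees `deg`, and its members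
of any given degree are linearly independent modulo the decomposable invariants. -/
structure IsIndecomposableFamily (Γ : Type*) [Group Γ] [MulSemiringAction Γ (MvPolynomial σ K)]
    [SMulCommClass Γ K (MvPolynomial σ K)] (n : ι → MvPolynomial σ K) (deg : ι → ℕ) : Prop where
  mem_inv : ∀ i, n i ∈ PolyInv σ K Γ
  isHomogeneous : ∀ i, (n i).IsHomogeneous (deg i)
  deg_pos : ∀ i, 0 < deg i
  indep : ∀ (s : Finset ι) (c : ι → K) (d : ℕ), (∀ i ∈ s, c i ≠ 0 → deg i = d) →
    ∑ i ∈ s, c i • n i ∈ decomposables σ K Γ → ∀ i ∈ s, c i = 0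

variable [Fintype σ] [CharZero K] [Fintype Γ]

/-- A homogeneous relation `∑ i, h i * ∂ₖ (n i) = 0` with invariant coefficients is trivial: the
coefficients of least degree would otherwise yield a nontrivial linear combination of the `n i`
that is decomposable. -/
theorem IsIndecomposableFamily.eq_zero_of_sum_mul_pderiv_of_isHomogeneous
    {n : ι → MvPolynomial σ K} {deg : ι → ℕ}
    (hn : IsIndecomposableFamily Γ n deg) (hlin : ActsLinearly σ K Γ)
    (hrefl : Subgroup.closure {s : Γ | ∃ α : MvPolynomial σ K, MovesAlong s α} = ⊤)
    (s : Finset ι) (h : ι → PolyInv σ K Γ) (D : ℕ)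
    (hhom : ∀ i ∈ s, h i ≠ 0 → ∃ e, (h i : MvPolynomial σ K).IsHomogeneous e ∧ e + deg i = D)
    (hsum : ∀ k, ∑ i ∈ s, (h i : MvPolynomial σ K) * pderiv k (n i) = 0) :
    ∀ i ∈ s, h i = 0 := by
  classical
  by_contra! hne
  obtain ⟨j, hj, hjmax⟩ := Finset.exists_max_image (s.filter fun i => h i ≠ 0) deg
    (by obtain ⟨i, hi, hi0⟩ := hne; exact ⟨i, by simp [hi, hi0]⟩)
  rw [Finset.mem_filter] at hj
  obtain ⟨e, he, heD⟩ := hhom j hj.1 hj.2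
  obtain ⟨m, hm⟩ := exists_coeff_ne_zero (p := (h j : MvPolynomial σ K))
    (fun h0 => hj.2 (Subtype.ext h0))
  have hme : m.degree = e := by
    by_contra hcon
    exact hm (he.coeff_eq_zero hcon)
  -- `h j` has the least degree among the nonzero coefficients, so modulo the ideal `J` below,
  -- which misses `h j`, each `h i` is a scalar multiple of `h j`.
  set c : ι → K := fun i => coeff m (h i : MvPolynomial σ K) / coeff m (h j : MvPolynomial σ K)
    with hc
  have hcj : c j = 1 := div_self hm
  have hcdeg : ∀ i ∈ s, c i ≠ 0 → deg i = deg j := by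
    intro i hi hci
    have hi0 : coeff m (h i : MvPolynomial σ K) ≠ 0 := fun h0 => hci (by simp [hc, h0])
    obtain ⟨e', he', heD'⟩ := hhom i hi (fun h0 => hi0 (by simp [h0]))
    have : m.degree = e' := by
      by_contra hcon
      exact hi0 (he'.coeff_eq_zero hcon)
    omega
  set r : ι → PolyInv σ K Γ := fun i => h i - algebraMap K _ (c i) * h j with hr
  have hrcoe : ∀ i, (r i : MvPolynomial σ K) =
      (h i : MvPolynomial σ K) - C (c i) * (h j : MvPolynomial σ K) :=
    fun i => rfl
  have hrhom : ∀ i ∈ s, ∃ e', m.degree ≤ e' ∧ (r i : MvPolynomial σ K).IsHomogeneous e' := by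
    intro i hi
    by_cases hi0 : h i = 0
    · refine ⟨e, hme.le, ?_⟩
      rw [hrcoe, show c i = 0 by simp [hc, hi0], hi0]
      simpa using isHomogeneous_zero σ K e
    obtain ⟨e', he', heD'⟩ := hhom i hi hi0
    have hle := hjmax i (by simp [hi, hi0])
    refine ⟨e', by omega, ?_⟩
    rw [hrcoe]
    by_cases hci : c i = 0
    · rw [hci]
      simpa using he'
    · have := hcdeg i hi hci
      have hee : e' = e := by omega
      subst hee
      exact he'.sub (he.C_mul _)
  set J : Ideal (PolyInv σ K Γ) := Ideal.span (r '' (s : Set ι)) with hJ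
  have hJcoeff : ∀ x ∈ J, ∀ a : PolyInv σ K Γ,
      coeff m ((a : MvPolynomial σ K) * (x : MvPolynomial σ K)) = 0 := by
    intro x hx
    induction hx using Submodule.span_induction with
    | zero => simp
    | add x y _ _ hx hy => intro a; simp [mul_add, hx a, hy a]
    | smul b x _ hx =>
      intro a
      have := hx (a * b)
      rwa [MulMemClass.coe_mul, mul_assoc] at this
    | mem x hx =>
      obtain ⟨i, hi, rfl⟩ := hx
      intro a
      obtain ⟨e', hle, he'⟩ := hrhom i hi
      rw [coeff_mul_of_isHomogeneous he' hle, hrcoe, coeff_sub, coeff_C_mul, hc]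
      dsimp only
      rw [div_mul_cancel₀ _ hm, sub_self, mul_zero]
  have hjJ : h j ∉ J := fun hmem => hm (by simpa using hJcoeff _ hmem (1 : PolyInv σ K Γ))
  set f : MvPolynomial σ K := ∑ i ∈ s, c i • n i with hf
  have hfhom : f.IsHomogeneous (deg j) := by
    refine IsHomogeneous.sum _ _ _ fun i hi => ?_
    by_cases hci : c i = 0
    · rw [hci, zero_smul]
      exact isHomogeneous_zero _ _ _
    · rw [← hcdeg i hi hci]
      exact (homogeneousSubmodule σ K _).smul_mem _ (hn.isHomogeneous i)
  have hpd : ∀ k, pderiv k f ∈ hilbertIdeal σ K Γ := by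
    intro k
    refine hlin.mem_hilbertIdeal_of_smul_mem hrefl J (h j) hjJ hfhom.pderiv ?_
    have h1 : h j • pderiv k f = -∑ i ∈ s, r i • pderiv k (n i) := by
      have h2 : ∀ i, r i • pderiv k (n i) = (h i : MvPolynomial σ K) * pderiv k (n i) -
          (h j : MvPolynomial σ K) * (c i • pderiv k (n i)) := by
        intro i
        change (r i : MvPolynomial σ K) * _ = _
        rw [hrcoe, smul_eq_C_mul]
        ring
      simp_rw [h2]
      rw [Finset.sum_sub_distrib, hsum k, zero_sub, neg_neg, ← Finset.mul_sum, hf, map_sum]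
      simp_rw [Derivation.map_smul]
      rfl
    rw [h1]
    refine neg_mem (sum_mem fun i hi => Submodule.smul_mem_smul ?_ trivial)
    exact Ideal.subset_span ⟨i, hi, rfl⟩
  have hfinv : f ∈ PolyInv σ K Γ :=
    sum_mem fun i _ => (PolyInv σ K Γ).smul_mem (hn.mem_inv i) _
  -- Euler's identity writes `f` through its partial derivatives.
  have hfdec : f ∈ decomposables σ K Γ := by
    have h1 : reynolds (Γ := Γ) (∑ k : σ, X k * pderiv k f) =
        algebraMap K (PolyInv σ K Γ) (deg j : K) * ⟨f, hfinv⟩ := by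
      rw [hfhom.sum_X_mul_pderiv, map_nsmul]
      have := reynolds_coe (σ := σ) (K := K) (Γ := Γ) ⟨f, hfinv⟩
      dsimp only at this
      rw [this, nsmul_eq_mul, map_natCast]
    have h2 : (reynolds (Γ := Γ) (∑ k : σ, X k * pderiv k f) : MvPolynomial σ K) ∈
        decomposables σ K Γ := by
      rw [map_sum, AddSubmonoidClass.coe_finsetSum]
      exact sum_mem fun k _ => hlin.reynolds_mul_mem_decomposables (by simp) (hpd k)
    rw [h1] at h2
    have h3 := (decomposables σ K Γ).smul_mem (deg j : K)⁻¹ h2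
    have h4 : (deg j : K)⁻¹ • ((algebraMap K (PolyInv σ K Γ) (deg j : K) * ⟨f, hfinv⟩ :
        PolyInv σ K Γ) : MvPolynomial σ K) = f := by
      rw [smul_eq_C_mul]
      change C _ * (C _ * f) = f
      rw [← mul_assoc, ← C_mul, inv_mul_cancel₀ (by exact_mod_cast (hn.deg_pos j).ne'), C_1,
        one_mul]
    rwa [h4] at h3
  have := hn.indep s c (deg j) hcdeg hfdec j hj.1
  rw [hcj] at this
  exact one_ne_zero this

/-- The differentials of an indecomposable family are linearly independent over the
invariants. -/
theorem IsIndecomposableFamily.eq_zero_of_sum_mul_pderiv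
    {n : ι → MvPolynomial σ K} {deg : ι → ℕ}
    (hn : IsIndecomposableFamily Γ n deg) (hlin : ActsLinearly σ K Γ)
    (hrefl : Subgroup.closure {s : Γ | ∃ α : MvPolynomial σ K, MovesAlong s α} = ⊤)
    (s : Finset ι) (h : ι → PolyInv σ K Γ)
    (hsum : ∀ k, ∑ i ∈ s, (h i : MvPolynomial σ K) * pderiv k (n i) = 0) :
    ∀ i ∈ s, h i = 0 := by
  classical
  -- The components of degree `D - deg i` of the coefficients `h i` form a relation for each `D`.
  let h' : ℕ → ι → PolyInv σ K Γ := fun D i =>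
    if deg i ≤ D then ⟨homogeneousComponent (D - deg i) (h i : MvPolynomial σ K),
      hlin.homogeneousComponent_mem (h i).2 _⟩ else 0
  have key : ∀ D, ∀ i ∈ s, h' (D + 1) i = 0 := by
    intro D
    refine hn.eq_zero_of_sum_mul_pderiv_of_isHomogeneous hlin hrefl s (h' (D + 1)) (D + 1) ?_ ?_
    · intro i _ hi0
      by_cases hle : deg i ≤ D + 1
      · refine ⟨D + 1 - deg i, ?_, by omega⟩
        simp only [h', if_pos hle]
        exact homogeneousComponent_isHomogeneous _ _
      · exact absurd (if_neg hle) hi0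
    · intro k
      have h1 := congrArg (homogeneousComponent D) (hsum k)
      rw [map_zero, map_sum] at h1
      rw [← h1]
      refine Finset.sum_congr rfl fun i _ => ?_
      have hpos := hn.deg_pos i
      have hpd : (pderiv k (n i)).IsHomogeneous (deg i - 1) := (hn.isHomogeneous i).pderiv
      rw [homogeneousComponent_mul_of_isHomogeneous hpd]
      by_cases hle : deg i ≤ D + 1
      · rw [if_pos (by omega), show D - (deg i - 1) = D + 1 - deg i by omega]
        simp only [h', if_pos hle]
      · rw [if_neg (by omega)]
        simp only [h', if_neg hle, ZeroMemClass.coe_zero, zero_mul]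
  intro i hi
  apply Subtype.ext
  rw [← sum_homogeneousComponent (h i : MvPolynomial σ K)]
  refine Finset.sum_eq_zero fun e _ => ?_
  obtain ⟨d, hd⟩ : ∃ d, deg i = d + 1 := Nat.exists_eq_succ_of_ne_zero (hn.deg_pos i).ne'
  have := congrArg Subtype.val (key (e + d) i hi)
  simpa [h', hd, add_assoc] using this

/-- Indecomposable families of invariants of a reflection group are algebraically independent:
differentiating a relation of least degree gives a relation between the differentials. -/
theorem IsIndecomposableFamily.algebraicIndependent
    {n : ι → MvPolynomial σ K} {deg : ι → ℕ}
    (hn : IsIndecomposableFamily Γ n deg) (hlin : ActsLinearly σ K Γ)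
    (hrefl : Subgroup.closure {s : Γ | ∃ α : MvPolynomial σ K, MovesAlong s α} = ⊤) :
    AlgebraicIndependent K n := by
  classical
  refine algebraicIndependent_of_finite_type fun t ht => ?_
  have : Fintype t := ht.fintype
  refine (injective_iff_map_eq_zero _).2 fun P hP => ?_
  induction hN : P.totalDegree using Nat.strong_induction_on generalizing P with
  | _ N ih =>
    have hd : ∀ i, aeval (fun i : t => n i) (pderiv i P) = 0 := by
      let n' : t → PolyInv σ K Γ := fun i => ⟨n i, hn.mem_inv i⟩
      have hcoe : ∀ Q : MvPolynomial t K, ((aeval n' Q : PolyInv σ K Γ) : MvPolynomial σ K) =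
          aeval (fun i : t => n i) Q := fun Q =>
        DFunLike.congr_fun (comp_aeval n' (PolyInv σ K Γ).val) Q
      have hn' : IsIndecomposableFamily Γ (fun i : t => n i) (fun i => deg i) :=
        { mem_inv := fun i => hn.mem_inv i
          isHomogeneous := fun i => hn.isHomogeneous i
          deg_pos := fun i => hn.deg_pos i
          indep := fun s c d hc hs i hi => by
            have hext : ∀ j : t, Function.extend Subtype.val c 0 (j : ι) = c j :=
              fun j => Subtype.val_injective.extend_apply c 0 j
            have h1 := hn.indep (s.map (Function.Embedding.subtype _))
              (Function.extend Subtype.val c 0) d (fun j hj => by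
                obtain ⟨k, hk, rfl⟩ := Finset.mem_map.1 hj
                change Function.extend Subtype.val c 0 (k : ι) ≠ 0 → deg (k : ι) = d
                rw [hext]
                exact hc k hk)
              (by simpa [hext] using hs) i (by simpa using hi)
            rwa [hext] at h1 }
      have h0 := hn'.eq_zero_of_sum_mul_pderiv hlin hrefl Finset.univ
        (fun i => aeval n' (pderiv i P)) fun k => by
          simp_rw [hcoe]
          refine (pderiv_aeval (fun i : t => n i) P k).symm.trans ?_
          rw [hP, map_zero]
      intro i
      rw [← hcoe, h0 i (Finset.mem_univ i)]
      rfl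
    have hd0 : ∀ i, pderiv i P = 0 := by
      intro i
      by_contra hne
      exact hne (ih _ (hN ▸ totalDegree_pderiv_lt i hne) _ (hd i) rfl)
    have hPC := eq_C_of_pderiv_eq_zero hd0
    rw [hPC, aeval_C] at hP
    rw [hPC, C_injective _ _ (hP.trans C_0.symm), C_0]

end AlgebraicIndependence

end ReflQuot

/-! ### Chevalley's theorem with a stable space of generators -/

namespace ReflQuot

open MvPolynomial

/-- Maschke's theorem for a linear action of a finite group: a stable subspace has a stable
complement. -/
lemma exists_smul_stable_isCompl {K G W : Type*} [Field K] [CharZero K] [Group G] [Finite G]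
    [AddCommGroup W] [Module K W] [DistribMulAction G W] [SMulCommClass G K W]
    (M : Submodule K W) (hM : ∀ (g : G), ∀ w ∈ M, g • w ∈ M) :
    ∃ C : Submodule K W, IsCompl M C ∧ ∀ (g : G), ∀ w ∈ C, g • w ∈ C := by
  let ρ : Representation K G W := Representation.ofDistribMulAction K G W
  have : NeZero (Nat.card G : K) := ⟨by exact_mod_cast Nat.card_pos.ne'⟩
  have : ComplementedLattice (Subrepresentation ρ) :=
    ρ.isSemisimpleRepresentation_iff_isSemisimpleModule_asModule.2 inferInstance
  obtain ⟨C, hC⟩ := exists_isCompl (⟨M, fun g w hw => hM g w hw⟩ : Subrepresentation ρ)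
  refine ⟨C.toSubmodule, IsCompl.of_eq ?_ ?_, fun g w hw => C.apply_mem_toSubmodule g hw⟩
  · exact congrArg Subrepresentation.toSubmodule hC.inf_eq_bot
  · exact congrArg Subrepresentation.toSubmodule hC.sup_eq_top

section Chevalley

variable {σ K : Type*} [Field K]

variable (σ K) in
lemma iSupIndep_homogeneousSubmodule : iSupIndep fun d => homogeneousSubmodule σ K d := by
  let := MvPolynomial.gradedAlgebra (σ := σ) (R := K)
  exact (DirectSum.Decomposition.isInternal (homogeneousSubmodule σ K)).submodule_iSupIndep

section Invariants

variable {Γ : Type*} [Group Γ] [MulSemiringAction Γ (MvPolynomial σ K)]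
  [SMulCommClass Γ K (MvPolynomial σ K)]

variable (σ K Γ) in
/-- The space of homogeneous invariants of degree `d`. -/
noncomputable def homInv (d : ℕ) : Submodule K (MvPolynomial σ K) :=
  Subalgebra.toSubmodule (PolyInv σ K Γ) ⊓ homogeneousSubmodule σ K d

lemma ActsLinearly.homogeneousComponent_mem_homInv (hlin : ActsLinearly σ K Γ)
    {f : MvPolynomial σ K} (hf : f ∈ PolyInv σ K Γ) (d : ℕ) :
    homogeneousComponent d f ∈ homInv σ K Γ d :=
  ⟨hlin.homogeneousComponent_mem hf d, homogeneousComponent_isHomogeneous d f⟩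

/-- Complements of the decomposable invariants in each degree generate all invariants. -/
theorem ActsLinearly.adjoin_eq_polyInv (hlin : ActsLinearly σ K Γ) (B : Set (MvPolynomial σ K))
    (hB : B ⊆ PolyInv σ K Γ)
    (hBd : ∀ d, homInv σ K Γ (d + 1) ≤ decomposables σ K Γ ⊔
      Submodule.span K B ⊓ homogeneousSubmodule σ K (d + 1)) :
    Algebra.adjoin K B = PolyInv σ K Γ := by
  apply le_antisymm (Algebra.adjoin_le hB)
  have hspan : ∀ e ∈ Submodule.span K B, e ∈ Algebra.adjoin K B := fun e he =>
    Algebra.span_le_adjoin K B he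
  have key : ∀ d, ∀ f ∈ homInv σ K Γ d, f ∈ Algebra.adjoin K B := by
    intro d
    induction d using Nat.strong_induction_on with
    | _ d ih =>
      intro f hf
      obtain _ | d := d
      · rw [totalDegree_eq_zero_iff_eq_C.1 ((totalDegree_zero_iff_isHomogeneous σ).2 hf.2)]
        exact (Algebra.adjoin K B).algebraMap_mem _
      -- Products of two components of positive degree only involve components of lower degree.
      have hdec : ∀ m ∈ decomposables σ K Γ,
          homogeneousComponent (d + 1) m ∈ Algebra.adjoin K B := by
        intro m hm
        induction hm using Submodule.mul_induction_on' with
        | add x _ y _ hx hy =>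
          rw [map_add]
          exact add_mem hx hy
        | mem_mul_mem x hx y hy =>
          rw [← sum_homogeneousComponent y, Finset.mul_sum, map_sum]
          refine sum_mem fun i _ => ?_
          rw [homogeneousComponent_mul_of_isHomogeneous (homogeneousComponent_isHomogeneous i y)]
          split_ifs with hi
          · obtain rfl | hi0 := Nat.eq_zero_or_pos i
            · rw [homogeneousComponent_zero, ← constantCoeff_eq, (mem_posInv.1 hy).2, C_0, mul_zero]
              exact zero_mem _
            obtain rfl | hid := Nat.eq_or_lt_of_le hi
            · rw [Nat.sub_self, homogeneousComponent_zero, ← constantCoeff_eq, (mem_posInv.1 hx).2,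
                C_0, zero_mul]
              exact zero_mem _
            · exact mul_mem (ih _ (by omega) _ (hlin.homogeneousComponent_mem_homInv hx.1 _))
                (ih _ hid _ (hlin.homogeneousComponent_mem_homInv hy.1 _))
          · exact zero_mem _
      obtain ⟨m, hm, e, he, rfl⟩ := Submodule.mem_sup.1 (hBd d hf)
      rw [← homogeneousComponent_eq_self hf.2, map_add, homogeneousComponent_eq_self he.2]
      exact add_mem (hdec m hm) (hspan e he.1)
  intro f hf
  rw [← sum_homogeneousComponent f]
  exact sum_mem fun d _ => key d _ (hlin.homogeneousComponent_mem_homInv hf d)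

/-- A family of algebraically independent generators of the invariants of a finite group has as
many members as there are variables. -/
theorem card_eq_of_adjoin_eq_polyInv [Finite Γ] {ι : Type*}
    {n : ι → MvPolynomial σ K}
    (hn : AlgebraicIndependent K n) (hgen : Algebra.adjoin K (Set.range n) = PolyInv σ K Γ) :
    Nonempty (σ ≃ ι) := by
  have : Algebra.IsInvariant (PolyInv σ K Γ) (MvPolynomial σ K) Γ :=
    ⟨fun f hf => ⟨⟨f, hf⟩, rfl⟩⟩
  have : Algebra.IsIntegral (PolyInv σ K Γ) (MvPolynomial σ K) :=
    Algebra.IsInvariant.isIntegral (PolyInv σ K Γ) (MvPolynomial σ K) Γ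
  have h1 : IsTranscendenceBasis K n := by
    rw [hn.isTranscendenceBasis_iff_isAlgebraic, hgen]
    infer_instance
  have h2 := h1.lift_cardinalMk_eq (IsTranscendenceBasis.mvPolynomial σ K)
  exact (Cardinal.lift_mk_eq'.1 h2).map Equiv.symm

end Invariants

/-- The theorem of Chevalley, with stability: the invariants of a normal subgroup `N` generated by
reflections of a finite linear group `G` are a polynomial algebra, on homogeneous generators whose
span is stable under `G`. -/
theorem exists_stable_fundamental_invariants [Fintype σ] [CharZero K] {G : Type*} [Group G]
    [Finite G] [MulSemiringAction G (MvPolynomial σ K)] [SMulCommClass G K (MvPolynomial σ K)]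
    (hlin : ActsLinearly σ K G) (N : Subgroup G) [N.Normal]
    (hrefl : Subgroup.closure {s : N | ∃ α : MvPolynomial σ K, MovesAlong s α} = ⊤) :
    ∃ n : σ → MvPolynomial σ K,
      (∀ i, ∃ d, (n i).IsHomogeneous d) ∧ AlgebraicIndependent K n ∧
      Algebra.adjoin K (Set.range n) = PolyInv σ K N ∧
      ∀ (g : G), ∀ f ∈ Submodule.span K (Set.range n), g • f ∈ Submodule.span K (Set.range n) := by
  classical
  have : Fintype N := Fintype.ofFinite N
  have hlinN : ActsLinearly σ K N := fun g i => hlin g i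
  have hinv : ∀ (g : G), ∀ f ∈ PolyInv σ K N, g • f ∈ PolyInv σ K N := by
    intro g f hf ⟨a, ha⟩
    have h1 : g⁻¹ * a * g ∈ N := by simpa using ‹N.Normal›.conj_mem a ha g⁻¹
    have h2 : (g⁻¹ * a * g) • f = f := hf ⟨_, h1⟩
    change a • g • f = g • f
    conv_rhs => rw [← h2]
    rw [smul_smul, smul_smul]
    congr 1
    group
  have hhomInv : ∀ (d : ℕ) (g : G), ∀ f ∈ homInv σ K N d, g • f ∈ homInv σ K N d :=
    fun d g f hf => ⟨hinv g f hf.1, hlin.smul_isHomogeneous g hf.2⟩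
  have hposInv : ∀ (g : G), ∀ f ∈ posInv σ K N, g • f ∈ posInv σ K N :=
    fun g f hf => ⟨hinv g f hf.1, (hlin.constantCoeff_smul g f).trans hf.2⟩
  have hdec : ∀ (g : G), ∀ f ∈ decomposables σ K N, g • f ∈ decomposables σ K N := by
    intro g f hf
    induction hf using Submodule.mul_induction_on' with
    | add x _ y _ hx hy =>
      rw [smul_add]
      exact add_mem hx hy
    | mem_mul_mem x hx y hy =>
      rw [smul_mul']
      exact Submodule.mul_mem_mul (hposInv g x hx) (hposInv g y hy)
  have hC := fun d => exists_smul_stable_isCompl (K := K) (G := G)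
    (decomposables σ K N ⊓ homInv σ K N (d + 1))
    (fun g f hf => ⟨hdec g f hf.1, hhomInv _ g f hf.2⟩)
  choose C hCcompl hCstable using hC
  -- `E d` is a stable complement of the decomposable invariants among those of degree `d + 1`.
  let E : ℕ → Submodule K (MvPolynomial σ K) := fun d => C d ⊓ homInv σ K N (d + 1)
  have hEstable : ∀ d (g : G), ∀ f ∈ E d, g • f ∈ E d :=
    fun d g f hf => ⟨hCstable d g f hf.1, hhomInv _ g f hf.2⟩
  have hEdec : ∀ d, ∀ f ∈ E d, f ∈ decomposables σ K N → f = 0 := fun d f hf hfd =>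
    (Submodule.disjoint_def.1 (hCcompl d).disjoint) f ⟨hfd, hf.2⟩ hf.1
  let ι := Σ d, Module.Basis.ofVectorSpaceIndex K (E d)
  let b : ∀ d, Module.Basis.ofVectorSpaceIndex K (E d) → MvPolynomial σ K :=
    fun d i => (Module.Basis.ofVectorSpace K (E d) i : E d)
  have hbspan : ∀ d, Submodule.span K (Set.range (b d)) = E d := by
    intro d
    have h1 := congrArg (Submodule.map (E d).subtype) (Module.Basis.ofVectorSpace K (E d)).span_eq
    rw [Submodule.map_span, ← Set.range_comp, Submodule.map_top, Submodule.range_subtype] at h1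
    exact h1
  let n : ι → MvPolynomial σ K := fun i => b i.1 i.2
  have hnE : ∀ i, n i ∈ E i.1 := fun i => (Module.Basis.ofVectorSpace K (E i.1) i.2).2
  have hnspan : Submodule.span K (Set.range n) = ⨆ d, E d := by
    rw [Set.range_sigma_eq_iUnion_range, Submodule.span_iUnion]
    exact iSup_congr hbspan
  have hnli : LinearIndependent K n := by
    refine linearIndependent_iUnion_finite (f := b) (fun d => ?_) fun d t _ hdt => ?_
    · exact (Module.Basis.ofVectorSpace K (E d)).linearIndependent.map' (E d).subtype
        (Submodule.ker_subtype _)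
    · have h1 : iSupIndep fun d => homogeneousSubmodule σ K (d + 1) :=
        (iSupIndep_homogeneousSubmodule σ K).comp (add_left_injective 1)
      have h2 : iSupIndep E := h1.mono fun d f hf => hf.2.2
      simp_rw [hbspan]
      exact h2.disjoint_biSup hdt
  have hind : IsIndecomposableFamily N n (fun i => i.1 + 1) :=
    { mem_inv := fun i => (hnE i).2.1
      isHomogeneous := fun i => (hnE i).2.2
      deg_pos := fun i => Nat.succ_pos _
      indep := fun s c d hc hs => by
        obtain _ | d := d
        · intro i hi
          by_contra h0
          exact absurd (hc i hi h0) (Nat.succ_ne_zero _)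
        refine linearIndependent_iff'.1 hnli s c (hEdec d _ (sum_mem fun i hi => ?_) hs)
        by_cases hi0 : c i = 0
        · rw [hi0, zero_smul]
          exact zero_mem _
        · have := Nat.succ_injective (hc i hi hi0)
          rw [← this]
          exact Submodule.smul_mem _ _ (hnE i) }
  have halg := hind.algebraicIndependent hlinN hrefl
  have hgen : Algebra.adjoin K (Set.range n) = PolyInv σ K N := by
    refine hlinN.adjoin_eq_polyInv _ ?_ fun d f hf => ?_
    · rintro _ ⟨i, rfl⟩
      exact hind.mem_inv i
    · obtain ⟨m, hm, c, hc, rfl⟩ := Submodule.mem_sup.1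
        ((hCcompl d).sup_eq_top ▸ Submodule.mem_top (x := f))
      refine Submodule.add_mem_sup hm.1 ?_
      rw [hnspan]
      have hc' : c ∈ homInv σ K N (d + 1) := by simpa using sub_mem hf hm.2
      exact ⟨Submodule.mem_iSup_of_mem d ⟨hc, hc'⟩, hc'.2⟩
  obtain ⟨e⟩ := card_eq_of_adjoin_eq_polyInv halg hgen
  have hrange : Set.range (n ∘ e) = Set.range n := e.surjective.range_comp n
  refine ⟨n ∘ e, fun i => ⟨_, hind.isHomogeneous (e i)⟩, halg.comp e e.injective, ?_, ?_⟩
  · rw [hrange, hgen]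
  · rw [hrange, hnspan]
    intro g f hf
    induction hf using Submodule.iSup_induction' with
    | mem d x hx => exact Submodule.mem_iSup_of_mem d (hEstable d g x hx)
    | zero => simp
    | add x y _ _ hx hy =>
      rw [smul_add]
      exact add_mem hx hy

end Chevalley

end ReflQuot

/-! ### Polynomial functions on `V` and coordinates -/

namespace ReflQuot

open Module

variable {V : Type*} [AddCommGroup V] [Module ℂ V]

section Action

lemma act_ι (g : LinearMap.GeneralLinearGroup ℂ V) (φ : Dual ℂ V) :
    act g (SymmetricAlgebra.ι ℂ (Dual ℂ V) φ) =
      SymmetricAlgebra.ι ℂ (Dual ℂ V) (φ ∘ₗ (↑g⁻¹ : V →ₗ[ℂ] V)) :=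
  SymmetricAlgebra.lift_ι_apply _ _

lemma evalAt_ι (v : V) (φ : Dual ℂ V) :
    evalAt v (SymmetricAlgebra.ι ℂ (Dual ℂ V) φ) = φ v :=
  SymmetricAlgebra.lift_ι_apply _ _

lemma act_one : act (1 : LinearMap.GeneralLinearGroup ℂ V) = AlgHom.id ℂ (PolyFun V) :=
  SymmetricAlgebra.algHom_ext <| LinearMap.ext fun φ => by
    change act 1 (SymmetricAlgebra.ι ℂ (Dual ℂ V) φ) = SymmetricAlgebra.ι ℂ (Dual ℂ V) φ
    rw [act_ι, inv_one]
    rfl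

lemma act_mul (g h : LinearMap.GeneralLinearGroup ℂ V) :
    act (g * h) = (act g).comp (act h) :=
  SymmetricAlgebra.algHom_ext <| LinearMap.ext fun φ => by
    change act (g * h) (SymmetricAlgebra.ι ℂ (Dual ℂ V) φ) =
      act g (act h (SymmetricAlgebra.ι ℂ (Dual ℂ V) φ))
    rw [act_ι, act_ι, act_ι, mul_inv_rev]
    rfl

/-- The action of `GL(V)` on polynomial functions, as a `MulSemiringAction`. -/
noncomputable instance : MulSemiringAction (LinearMap.GeneralLinearGroup ℂ V) (PolyFun V) where
  smul g f := act g f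
  one_smul f := by
    change act 1 f = f
    rw [act_one]
    rfl
  mul_smul g h f := by
    change act (g * h) f = act g (act h f)
    rw [act_mul]
    rfl
  smul_zero g := map_zero (act g)
  smul_add g := map_add (act g)
  smul_one g := map_one (act g)
  smul_mul g := map_mul (act g)

lemma smul_polyFun_def (g : LinearMap.GeneralLinearGroup ℂ V) (f : PolyFun V) : g • f = act g f :=
  rfl

instance : SMulCommClass (LinearMap.GeneralLinearGroup ℂ V) ℂ (PolyFun V) :=
  ⟨fun g c f => map_smul (act g) c f⟩

lemma evalAt_smul (g : LinearMap.GeneralLinearGroup ℂ V) (v : V) (f : PolyFun V) :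
    evalAt v (g • f) = evalAt (g⁻¹ • v) f := by
  have h : (evalAt v).comp (act g) = evalAt (g⁻¹ • v) :=
    SymmetricAlgebra.algHom_ext <| LinearMap.ext fun φ => by
      change evalAt v (act g (SymmetricAlgebra.ι ℂ (Dual ℂ V) φ)) =
        evalAt (g⁻¹ • v) (SymmetricAlgebra.ι ℂ (Dual ℂ V) φ)
      rw [act_ι, evalAt_ι, evalAt_ι]
      rfl
  exact DFunLike.congr_fun h f

lemma mem_invariants {Γ : Subgroup (LinearMap.GeneralLinearGroup ℂ V)} {f : PolyFun V} :
    f ∈ invariants Γ ↔ ∀ g ∈ Γ, g • f = f := by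
  simp only [invariants, Algebra.mem_iInf]
  rfl

end Action

/-- A linear form that vanishes on the kernel of another one is a multiple of it. -/
lemma exists_eq_smul_of_ker_le {φ ψ : Dual ℂ V} (h : LinearMap.ker φ ≤ LinearMap.ker ψ) :
    ∃ c : ℂ, ψ = c • φ := by
  by_cases hφ : φ = 0
  · refine ⟨0, ?_⟩
    rw [hφ, LinearMap.ker_zero, top_le_iff, LinearMap.ker_eq_top] at h
    rw [h, zero_smul]
  obtain ⟨u, hu⟩ := DFunLike.ne_iff.1 hφ
  refine ⟨ψ u / φ u, LinearMap.ext fun v => ?_⟩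
  have hu' : φ u ≠ 0 := hu
  have h1 : v - (φ v / φ u) • u ∈ LinearMap.ker φ := by
    simp [div_mul_cancel₀ _ hu']
  have h2 : ψ v - φ v / φ u * ψ u = 0 := by simpa using h h1
  rw [LinearMap.smul_apply, smul_eq_mul, sub_eq_zero.1 h2]
  field_simp

lemma exists_ker_eq_of_isCoatom {W : Submodule ℂ V} (hW : IsCoatom W) :
    ∃ φ : Dual ℂ V, φ ≠ 0 ∧ LinearMap.ker φ = W := by
  obtain ⟨φ, hφ, hWφ⟩ := W.exists_le_ker_of_lt_top hW.lt_top
  exact ⟨φ, hφ, (hW.le_iff.1 hWφ).resolve_left fun h => hφ (LinearMap.ker_eq_top.1 h)⟩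

/-- A reflection moves every polynomial function by a multiple of the equation of its
hyperplane. -/
lemma IsReflection.exists_dvd_smul_sub {g : LinearMap.GeneralLinearGroup ℂ V}
    (hg : IsReflection g) :
    ∃ φ : Dual ℂ V, φ ≠ 0 ∧
      ∀ p : PolyFun V, SymmetricAlgebra.ι ℂ (Dual ℂ V) φ ∣ g • p - p := by
  obtain ⟨W, hW, hfix⟩ := hg
  obtain ⟨φ, hφ, hker⟩ := exists_ker_eq_of_isCoatom hW
  refine ⟨φ, hφ, fun p => ?_⟩
  induction p using SymmetricAlgebra.induction with
  | algebraMap r =>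
    rw [smul_algebraMap, sub_self]
    exact dvd_zero _
  | ι ψ =>
    rw [smul_polyFun_def, act_ι, ← map_sub]
    obtain ⟨c, hc⟩ := exists_eq_smul_of_ker_le (φ := φ)
      (ψ := ψ ∘ₗ (↑g⁻¹ : V →ₗ[ℂ] V) - ψ) (by
        rw [hker]
        intro w hw
        have h1 : g⁻¹ • w = w := by rw [inv_smul_eq_iff, hfix w hw]
        have h2 : (↑g⁻¹ : V →ₗ[ℂ] V) w = w := h1
        simp [h2])
    rw [hc, map_smul]
    exact dvd_smul_of_dvd c dvd_rfl
  | mul a b ha hb =>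
    have : g • (a * b) - a * b = g • a * (g • b - b) + (g • a - a) * b := by
      rw [smul_mul']
      ring
    rw [this]
    exact dvd_add (hb.mul_left _) (ha.mul_right _)
  | add a b ha hb =>
    have : g • (a + b) - (a + b) = (g • a - a) + (g • b - b) := by
      rw [smul_add]
      ring
    rw [this]
    exact dvd_add ha hb

section Coordinates

variable {ι : Type*} (b : Basis ι ℂ (Dual ℂ V))

lemma map_range_ι_pow (d : ℕ) :
    (LinearMap.range (SymmetricAlgebra.ι ℂ (Dual ℂ V)) ^ d).map
      (SymmetricAlgebra.equivMvPolynomial b).toAlgHom.toLinearMap =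
        MvPolynomial.homogeneousSubmodule ι ℂ d := by
  rw [Submodule.map_pow, ← MvPolynomial.homogeneousSubmodule_one_pow]
  congr 1
  rw [MvPolynomial.homogeneousSubmodule_one_eq_span_X, LinearMap.range_eq_map, ← b.span_eq,
    Submodule.map_span, Submodule.map_span, ← Set.range_comp, ← Set.range_comp]
  congr 2
  ext i
  simp

lemma isHomogeneousOfDegree_symm {p : MvPolynomial ι ℂ} {d : ℕ} (hp : p.IsHomogeneous d) :
    IsHomogeneousOfDegree ((SymmetricAlgebra.equivMvPolynomial b).symm p) d := by
  have h : p ∈ MvPolynomial.homogeneousSubmodule ι ℂ d := hp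
  rw [← map_range_ι_pow b] at h
  obtain ⟨f, hf, rfl⟩ := h
  have : (SymmetricAlgebra.equivMvPolynomial b).symm
      ((SymmetricAlgebra.equivMvPolynomial b).toAlgHom.toLinearMap f) = f :=
    (SymmetricAlgebra.equivMvPolynomial b).symm_apply_apply f
  rw [this]
  exact hf

lemma isHomogeneous_equivMvPolynomial_ι (φ : Dual ℂ V) :
    (SymmetricAlgebra.equivMvPolynomial b
      (SymmetricAlgebra.ι ℂ (Dual ℂ V) φ)).IsHomogeneous 1 := by
  have h : SymmetricAlgebra.equivMvPolynomial b (SymmetricAlgebra.ι ℂ (Dual ℂ V) φ) ∈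
      MvPolynomial.homogeneousSubmodule ι ℂ 1 := by
    rw [← map_range_ι_pow b, pow_one]
    exact ⟨_, ⟨φ, rfl⟩, rfl⟩
  exact h

/-- The action of `G ⊆ GL(V)` on polynomial functions, written in the coordinates given by a basis
of `V*`. -/
@[reducible] noncomputable def coordAction (G : Subgroup (LinearMap.GeneralLinearGroup ℂ V)) :
    MulSemiringAction G (MvPolynomial ι ℂ) where
  smul g p := SymmetricAlgebra.equivMvPolynomial b
    (g • (SymmetricAlgebra.equivMvPolynomial b).symm p)
  one_smul p := by
    change SymmetricAlgebra.equivMvPolynomial b _ = p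
    simp
  mul_smul g h p := by
    change SymmetricAlgebra.equivMvPolynomial b _ = SymmetricAlgebra.equivMvPolynomial b
      (g • (SymmetricAlgebra.equivMvPolynomial b).symm (SymmetricAlgebra.equivMvPolynomial b _))
    rw [AlgEquiv.symm_apply_apply, mul_smul]
  smul_zero g := by
    change SymmetricAlgebra.equivMvPolynomial b _ = 0
    simp
  smul_add g p q := by
    change SymmetricAlgebra.equivMvPolynomial b _ = SymmetricAlgebra.equivMvPolynomial b _ +
      SymmetricAlgebra.equivMvPolynomial b _
    rw [map_add, smul_add, map_add]
  smul_one g := by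
    change SymmetricAlgebra.equivMvPolynomial b _ = 1
    rw [map_one, smul_one, map_one]
  smul_mul g p q := by
    change SymmetricAlgebra.equivMvPolynomial b _ = SymmetricAlgebra.equivMvPolynomial b _ *
      SymmetricAlgebra.equivMvPolynomial b _
    rw [map_mul, smul_mul', map_mul]

end Coordinates

/-- A normal subgroup generated by reflections has fundamental invariants with stable span. -/
theorem exists_isFundamentalInvariants_stable [FiniteDimensional ℂ V]
    (G : Subgroup (LinearMap.GeneralLinearGroup ℂ V)) [Finite G] (N : Subgroup G) [N.Normal]
    (hN : IsGeneratedByReflections (N.map G.subtype)) :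
    ∃ n : Fin (finrank ℂ V) → PolyFun V, IsFundamentalInvariants (N.map G.subtype) n ∧
      ∀ (g : G), ∀ f ∈ spanOf n, g • f ∈ spanOf n := by
  let b := (finBasis ℂ V).dualBasis
  let e := SymmetricAlgebra.equivMvPolynomial b
  let := coordAction b G
  have hsmul : ∀ (g : G) (p : MvPolynomial (Fin (finrank ℂ V)) ℂ), g • p = e (g • e.symm p) :=
    fun _ _ => rfl
  have hsmul' : ∀ (g : G) (f : PolyFun V), e.symm (g • e f) = g • f := fun g f => by
    rw [hsmul, e.symm_apply_apply, e.symm_apply_apply]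
  have : SMulCommClass G ℂ (MvPolynomial (Fin (finrank ℂ V)) ℂ) := ⟨fun g c p => by
    rw [hsmul, hsmul, map_smul e.symm, smul_comm]
    exact map_smul e c _⟩
  have hlin : ActsLinearly (Fin (finrank ℂ V)) ℂ G := fun g i => by
    rw [hsmul]
    change
      (e ((g : LinearMap.GeneralLinearGroup ℂ V) • e.symm (MvPolynomial.X i))).IsHomogeneous 1
    rw [SymmetricAlgebra.equivMvPolynomial_symm_X, smul_polyFun_def, act_ι]
    exact isHomogeneous_equivMvPolynomial_ι b _
  have hrefl : Subgroup.closure {s : N | ∃ α : MvPolynomial (Fin (finrank ℂ V)) ℂ,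
      MovesAlong s α} = ⊤ := by
    set T := {s : N | ∃ α : MvPolynomial (Fin (finrank ℂ V)) ℂ, MovesAlong s α}
    let j : N →* LinearMap.GeneralLinearGroup ℂ V := G.subtype.comp N.subtype
    have hj : Function.Injective j := G.subtype_injective.comp N.subtype_injective
    rw [← top_le_iff, ← Subgroup.map_le_map_iff_of_injective hj, MonoidHom.map_closure]
    have h1 : Subgroup.map j ⊤ = N.map G.subtype := by
      rw [← Subgroup.map_map, ← MonoidHom.range_eq_map, N.range_subtype]
    rw [h1, ← hN]
    apply Subgroup.closure_mono
    rintro _ ⟨⟨g, hg, rfl⟩, hr⟩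
    refine ⟨⟨g, hg⟩, ?_, rfl⟩
    obtain ⟨φ, hφ, hdvd⟩ := hr.exists_dvd_smul_sub
    refine ⟨e (SymmetricAlgebra.ι ℂ _ φ), ?_, isHomogeneous_equivMvPolynomial_ι b φ, fun p => ?_⟩
    · rw [Ne, map_eq_zero_iff e e.injective]
      intro h0
      refine hφ (LinearMap.ext fun v => ?_)
      rw [← evalAt_ι, h0, map_zero, LinearMap.zero_apply]
    · have h2 := map_dvd e (hdvd (e.symm p))
      rwa [map_sub, e.apply_symm_apply] at h2
  obtain ⟨n, hhom, halg, hgen, hst⟩ := exists_stable_fundamental_invariants hlin N hrefl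
  have hrange : Set.range (e.symm ∘ n) = e.symm '' Set.range n := Set.range_comp _ _
  have hspan : spanOf (e.symm ∘ n) =
      (Submodule.span ℂ (Set.range n)).map e.symm.toAlgHom.toLinearMap := by
    rw [spanOf, hrange, Submodule.map_span]
    rfl
  refine ⟨e.symm ∘ n, ⟨fun i => ?_, ?_, ?_⟩, ?_⟩
  · obtain ⟨d, hd⟩ := hhom i
    exact ⟨d, isHomogeneousOfDegree_symm b hd⟩
  · exact halg.map' (f := e.symm.toAlgHom) e.symm.injective
  · have h1 : Algebra.adjoin ℂ (Set.range (e.symm ∘ n)) =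
        (Algebra.adjoin ℂ (Set.range n)).map e.symm.toAlgHom := by
      rw [hrange, AlgHom.map_adjoin]
      rfl
    rw [h1, hgen]
    ext f
    rw [mem_invariants]
    constructor
    · rintro ⟨p, hp, rfl⟩ _ ⟨g, hg, rfl⟩
      have h2 : g • p = p := hp ⟨g, hg⟩
      have h3 := hsmul' g (e.symm p)
      rw [e.apply_symm_apply, h2] at h3
      exact h3.symm
    · intro hf
      refine ⟨e f, fun g => ?_, e.symm_apply_apply f⟩
      change (g : G) • e f = e f
      rw [hsmul, e.symm_apply_apply]
      exact congrArg e (hf _ ⟨g, g.2, rfl⟩)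
  · rw [hspan]
    rintro g _ ⟨p, hp, rfl⟩
    refine ⟨g • p, hst g p hp, ?_⟩
    have h3 := hsmul' g (e.symm p)
    rwa [e.apply_symm_apply] at h3

end ReflQuot

/-! ### The orbit space, and restriction to a hyperplane -/

namespace ReflQuot

open Module

variable {V : Type*} [AddCommGroup V] [Module ℂ V]

section Quotient

variable (Γ : Subgroup (LinearMap.GeneralLinearGroup ℂ V))

instance : Algebra.IsInvariant (invariants Γ) (PolyFun V) Γ :=
  ⟨fun f hf => ⟨⟨f, mem_invariants.2 fun g hg => hf ⟨g, hg⟩⟩, rfl⟩⟩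

instance : SMulCommClass Γ (invariants Γ) (PolyFun V) :=
  ⟨fun g r f => by
    rw [Algebra.smul_def, Algebra.smul_def, smul_mul']
    congr 1
    exact mem_invariants.1 r.2 g g.2⟩

variable {Γ}

/-- Evaluation at a vector, as a linear form on the span of a family of polynomial functions. -/
noncomputable def evalSpan {κ : Type*} (n : κ → PolyFun V) (v : V) : Dual ℂ (spanOf n) :=
  (evalAt v).toLinearMap ∘ₗ (spanOf n).subtype

lemma evalSpan_apply {κ : Type*} (n : κ → PolyFun V) (v : V) (f : spanOf n) :
    evalSpan n v f = evalAt v (f : PolyFun V) := rfl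

lemma spanOf_le_invariants {κ : Type*} {n : κ → PolyFun V}
    (hgen : Algebra.adjoin ℂ (Set.range n) = invariants Γ) {f : PolyFun V} (hf : f ∈ spanOf n) :
    f ∈ invariants Γ :=
  hgen ▸ Algebra.span_le_adjoin ℂ _ hf

variable [FiniteDimensional ℂ V]

lemma eq_of_forall_dual_eq {v w : V} (h : ∀ φ : Dual ℂ V, φ v = φ w) : v = w := by
  rw [← sub_eq_zero, ← Module.forall_dual_apply_eq_zero_iff ℂ]
  intro φ
  rw [map_sub, h, sub_self]

/-- The invariants of a finite group separate its orbits. -/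
theorem exists_smul_eq_of_evalSpan_eq [Finite Γ] {κ : Type*} {n : κ → PolyFun V}
    (hgen : Algebra.adjoin ℂ (Set.range n) = invariants Γ) {v w : V}
    (h : evalSpan n v = evalSpan n w) : ∃ g : Γ, g • v = w := by
  have hinv : ∀ f ∈ invariants Γ, evalAt v f = evalAt w f := by
    rw [← hgen]
    intro f hf
    have h1 : Algebra.adjoin ℂ (Set.range n) ≤ AlgHom.equalizer (evalAt v) (evalAt w) := by
      refine Algebra.adjoin_le ?_
      rintro _ ⟨i, rfl⟩
      exact DFunLike.congr_fun h ⟨n i, Submodule.subset_span ⟨i, rfl⟩⟩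
    exact h1 hf
  have hv : (RingHom.ker (evalAt v)).IsPrime := RingHom.ker_isPrime _
  have hw : (RingHom.ker (evalAt w)).IsPrime := RingHom.ker_isPrime _
  obtain ⟨g, hg⟩ := Algebra.IsInvariant.exists_smul_of_under_eq (invariants Γ) (PolyFun V) Γ
    (RingHom.ker (evalAt v)) (RingHom.ker (evalAt w)) (by
      ext r
      change evalAt v (r : PolyFun V) = 0 ↔ evalAt w (r : PolyFun V) = 0
      rw [hinv r r.2])
  refine ⟨g, ?_⟩
  rw [← eq_inv_smul_iff]
  refine eq_of_forall_dual_eq fun φ => ?_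
  have h1 : SymmetricAlgebra.ι ℂ (Dual ℂ V) φ - algebraMap ℂ _ (φ v) ∈ RingHom.ker (evalAt v) := by
    rw [RingHom.mem_ker, map_sub, evalAt_ι, AlgHom.commutes]
    exact sub_self _
  have h2 := Ideal.smul_mem_pointwise_smul g _ _ h1
  rw [← hg, RingHom.mem_ker] at h2
  have h3 : evalAt (g⁻¹ • w) (SymmetricAlgebra.ι ℂ (Dual ℂ V) φ - algebraMap ℂ _ (φ v)) = 0 :=
    (evalAt_smul (g : LinearMap.GeneralLinearGroup ℂ V) w _).symm.trans h2
  rw [map_sub, evalAt_ι, AlgHom.commutes] at h3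
  exact (sub_eq_zero.1 h3).symm

instance : Algebra.FiniteType ℂ (PolyFun V) :=
  Algebra.FiniteType.equiv inferInstance
    (SymmetricAlgebra.equivMvPolynomial (finBasis ℂ (Dual ℂ V))).symm

/-- Every character of the algebra of polynomial functions is the evaluation at a vector. -/
lemma exists_eq_evalAt (ψ : PolyFun V →ₐ[ℂ] ℂ) : ∃ v, ψ = evalAt v := by
  refine ⟨(evalEquiv ℂ V).symm (ψ.toLinearMap ∘ₗ SymmetricAlgebra.ι ℂ (Dual ℂ V)),
    SymmetricAlgebra.algHom_ext <| LinearMap.ext fun φ => ?_⟩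
  change _ = evalAt _ (SymmetricAlgebra.ι ℂ (Dual ℂ V) φ)
  rw [evalAt_ι, apply_evalEquiv_symm_apply]
  rfl

/-- Every character of the invariants of a finite group is the evaluation at a vector: it
extends to all polynomial functions by integrality and the Nullstellensatz. -/
theorem exists_evalAt_eq_of_invariants [Finite Γ] (χ : invariants Γ →ₐ[ℂ] ℂ) :
    ∃ v : V, ∀ f : invariants Γ, evalAt v (f : PolyFun V) = χ f := by
  have : Algebra.IsIntegral (invariants Γ) (PolyFun V) :=
    Algebra.IsInvariant.isIntegral (invariants Γ) (PolyFun V) Γ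
  have hmax : (RingHom.ker χ).IsMaximal := RingHom.ker_isMaximal_of_surjective χ fun c =>
    ⟨algebraMap ℂ _ c, χ.commutes c⟩
  have hker : RingHom.ker (algebraMap (invariants Γ) (PolyFun V)) ≤ RingHom.ker χ := by
    intro f hf
    have : f = 0 := Subtype.ext hf
    rw [this]
    exact zero_mem _
  obtain ⟨Q, hQ, hQχ⟩ := Ideal.exists_ideal_over_maximal_of_isIntegral (RingHom.ker χ) hker
  let := Ideal.Quotient.field Q
  have : Module.Finite ℂ (PolyFun V ⧸ Q) := finite_of_finite_type_of_isJacobsonRing ℂ _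
  let e : ℂ ≃ₐ[ℂ] PolyFun V ⧸ Q := AlgEquiv.ofBijective (Algebra.ofId ℂ _)
    (IsAlgClosed.algebraMap_bijective_of_isIntegral (k := ℂ) (K := PolyFun V ⧸ Q))
  obtain ⟨v, hv⟩ := exists_eq_evalAt (e.symm.toAlgHom.comp (Ideal.Quotient.mkₐ ℂ Q))
  refine ⟨v, fun f => ?_⟩
  have h1 : f - algebraMap ℂ _ (χ f) ∈ RingHom.ker χ := by
    rw [RingHom.mem_ker, map_sub, AlgHom.commutes]
    exact sub_self _
  rw [← hQχ, Ideal.mem_comap] at h1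
  have h2 : Ideal.Quotient.mkₐ ℂ Q ((f : PolyFun V) - algebraMap ℂ _ (χ f)) = 0 :=
    Ideal.Quotient.eq_zero_iff_mem.2 h1
  have h3 : evalAt v ((f : PolyFun V) - algebraMap ℂ _ (χ f)) = 0 := by
    rw [← hv, AlgHom.comp_apply, h2, map_zero]
  rw [map_sub, AlgHom.commutes] at h3
  exact sub_eq_zero.1 h3

/-- The quotient map onto `E` is surjective. -/
theorem evalSpan_surjective [Finite Γ] {κ : Type*} {n : κ → PolyFun V}
    (halg : AlgebraicIndependent ℂ n)
    (hgen : Algebra.adjoin ℂ (Set.range n) = invariants Γ) :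
    Function.Surjective (evalSpan n) := by
  intro e
  let c : κ → ℂ := fun i => e ⟨n i, Submodule.subset_span ⟨i, rfl⟩⟩
  let χ : invariants Γ →ₐ[ℂ] ℂ := ((MvPolynomial.aeval c).comp halg.aevalEquiv.symm.toAlgHom).comp
    (Subalgebra.equivOfEq _ _ hgen.symm).toAlgHom
  obtain ⟨v, hv⟩ := exists_evalAt_eq_of_invariants χ
  refine ⟨v, LinearMap.ext fun ⟨f, hf⟩ => ?_⟩
  rw [evalSpan_apply]
  induction hf using Submodule.span_induction with
  | mem x hx =>
    obtain ⟨i, rfl⟩ := hx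
    have hmem : n i ∈ Algebra.adjoin ℂ (Set.range n) := Algebra.subset_adjoin ⟨i, rfl⟩
    have h1 : halg.aevalEquiv (MvPolynomial.X i) = ⟨n i, hmem⟩ :=
      Subtype.ext (by simp)
    have h2 : χ ⟨n i, hgen ▸ hmem⟩ = c i := by
      change MvPolynomial.aeval c (halg.aevalEquiv.symm ⟨n i, hmem⟩) = c i
      rw [← h1, AlgEquiv.symm_apply_apply, MvPolynomial.aeval_X]
    exact (hv ⟨n i, hgen ▸ hmem⟩).trans h2
  | zero => exact (map_zero _).trans (map_zero e).symm
  | add x y hx hy hx' hy' =>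
    refine (map_add (evalAt v) x y).trans ?_
    rw [hx', hy', ← map_add]
    rfl
  | smul a x hx hx' =>
    refine (map_smul (evalAt v) a x).trans ?_
    rw [hx', ← map_smul]
    rfl

end Quotient

/-- An element of `GL(V)` that preserves all orbits of a finite group belongs to that group. -/
lemma mem_of_forall_exists_smul_eq {Γ : Subgroup (LinearMap.GeneralLinearGroup ℂ V)} [Finite Γ]
    {g : LinearMap.GeneralLinearGroup ℂ V} (h : ∀ v : V, ∃ x : Γ, x • v = g • v) : g ∈ Γ := by
  obtain ⟨x, hx⟩ := Subspace.exists_eq_top_of_iUnion_eq_univ (k := ℂ) (E := V)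
    (p := fun x : Γ => LinearMap.ker (((x : LinearMap.GeneralLinearGroup ℂ V) : V →ₗ[ℂ] V) -
      (g : V →ₗ[ℂ] V))) (by
      rw [Set.eq_univ_iff_forall]
      intro v
      obtain ⟨x, hx⟩ := h v
      exact Set.mem_iUnion.2 ⟨x, sub_eq_zero.2 hx⟩)
  rw [LinearMap.ker_eq_top, sub_eq_zero] at hx
  rw [← Units.ext hx]
  exact x.2

section Reflections

/-- Restriction of polynomial functions to a subspace. -/
noncomputable def restrictTo (W : Submodule ℂ V) : PolyFun V →ₐ[ℂ] PolyFun W :=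
  SymmetricAlgebra.lift (SymmetricAlgebra.ι ℂ (Dual ℂ W) ∘ₗ LinearMap.dualMap W.subtype)

lemma restrictTo_ι (W : Submodule ℂ V) (φ : Dual ℂ V) :
    restrictTo W (SymmetricAlgebra.ι ℂ (Dual ℂ V) φ) =
      SymmetricAlgebra.ι ℂ (Dual ℂ W) (φ ∘ₗ W.subtype) :=
  SymmetricAlgebra.lift_ι_apply _ _

lemma evalAt_restrictTo (W : Submodule ℂ V) (w : W) (f : PolyFun V) :
    evalAt w (restrictTo W f) = evalAt (w : V) f := by
  have h : (evalAt w).comp (restrictTo W) = evalAt (w : V) :=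
    SymmetricAlgebra.algHom_ext <| LinearMap.ext fun φ => by
      change evalAt w (restrictTo W (SymmetricAlgebra.ι ℂ (Dual ℂ V) φ)) =
        evalAt (w : V) (SymmetricAlgebra.ι ℂ (Dual ℂ V) φ)
      rw [restrictTo_ι, evalAt_ι, evalAt_ι]
      rfl
  exact DFunLike.congr_fun h f

lemma restrictTo_surjective (W : Submodule ℂ V) : Function.Surjective (restrictTo W) := by
  rw [← AlgHom.range_eq_top, ← top_le_iff]
  intro f _
  induction f using SymmetricAlgebra.induction with
  | algebraMap r => exact Subalgebra.algebraMap_mem _ r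
  | ι ψ =>
    obtain ⟨φ, rfl⟩ := LinearMap.exists_extend ψ
    exact ⟨_, restrictTo_ι W φ⟩
  | mul a b ha hb => exact mul_mem (ha trivial) (hb trivial)
  | add a b ha hb => exact add_mem (ha trivial) (hb trivial)

variable [FiniteDimensional ℂ V]

/-- A polynomial function that vanishes everywhere is zero. -/
lemma eq_zero_of_forall_evalAt_eq_zero {f : PolyFun V} (h : ∀ v, evalAt v f = 0) : f = 0 := by
  let b₀ := finBasis ℂ V
  let e := SymmetricAlgebra.equivMvPolynomial b₀.dualBasis
  have hev : ∀ v, (evalAt v).comp e.symm.toAlgHom =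
      MvPolynomial.aeval (fun i => b₀.dualBasis i v) :=
    fun v => MvPolynomial.algHom_ext fun i => by
      change evalAt v (e.symm (MvPolynomial.X i)) = _
      rw [SymmetricAlgebra.equivMvPolynomial_symm_X, evalAt_ι, MvPolynomial.aeval_X]
  rw [← map_eq_zero_iff e e.injective]
  refine MvPolynomial.funext fun x => ?_
  have h1 := DFunLike.congr_fun (hev (b₀.equivFun.symm x)) (e f)
  have h2 : (fun i => b₀.dualBasis i (b₀.equivFun.symm x)) = x := by
    ext i
    simp [b₀.coe_dualBasis, Finsupp.single_apply]
  rw [h2] at h1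
  change evalAt _ (e.symm (e f)) = _ at h1
  rw [e.symm_apply_apply, h] at h1
  rw [map_zero]
  exact h1.symm

lemma trdeg_polyFun : Algebra.trdeg ℂ (PolyFun V) = finrank ℂ V := by
  have h := (SymmetricAlgebra.equivMvPolynomial (finBasis ℂ V).dualBasis).lift_trdeg_eq
  rw [MvPolynomial.trdeg_of_isDomain] at h
  simpa using h

/-- The image of a subspace `W` of `V` in `E` is not contained in a subspace of dimension less
than `dim W`: otherwise the restrictions of the invariants to `W`, over which the polynomial
functions on `W` are integral, would be generated by less than `dim W` elements. -/
theorem finrank_le_of_evalSpan_mem {Γ : Subgroup (LinearMap.GeneralLinearGroup ℂ V)} [Finite Γ]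
    {κ : Type*} [Finite κ] {n : κ → PolyFun V}
    (hgen : Algebra.adjoin ℂ (Set.range n) = invariants Γ)
    (W : Submodule ℂ V) (F : Submodule ℂ (Dual ℂ (spanOf n)))
    (hF : ∀ w ∈ W, evalSpan n w ∈ F) : finrank ℂ W ≤ finrank ℂ F := by
  classical
  have : FiniteDimensional ℂ (spanOf n) := FiniteDimensional.span_of_finite ℂ (Set.finite_range n)
  let L : spanOf n →ₗ[ℂ] PolyFun W := (restrictTo W).toLinearMap ∘ₗ (spanOf n).subtype
  have hker : F.dualCoannihilator ≤ LinearMap.ker L := by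
    intro f hf
    rw [Submodule.mem_dualCoannihilator] at hf
    refine eq_zero_of_forall_evalAt_eq_zero fun w => ?_
    change evalAt w (restrictTo W (f : PolyFun V)) = 0
    rw [evalAt_restrictTo]
    exact hf _ (hF w w.2)
  have hrange : finrank ℂ (LinearMap.range L) ≤ finrank ℂ F := by
    have h1 := Submodule.finrank_mono hker
    have h2 := L.finrank_range_add_finrank_ker
    have h3 := Subspace.finrank_add_finrank_dualCoannihilator_eq F
    omega
  refine le_trans ?_ hrange
  let b := finBasis ℂ (LinearMap.range L)
  let s : Set (PolyFun W) := Set.range fun i => (b i : PolyFun W)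
  have hs : Submodule.span ℂ s = LinearMap.range L := by
    have h1 := congrArg (Submodule.map (LinearMap.range L).subtype) b.span_eq
    rw [Submodule.map_span, ← Set.range_comp, Submodule.map_top, Submodule.range_subtype] at h1
    exact h1
  have hmem : ∀ f ∈ invariants Γ, restrictTo W f ∈ Algebra.adjoin ℂ s := by
    rw [← hgen]
    have h1 : Algebra.adjoin ℂ (Set.range n) ≤ (Algebra.adjoin ℂ s).comap (restrictTo W) := by
      refine Algebra.adjoin_le ?_
      rintro _ ⟨i, rfl⟩
      refine Algebra.span_le_adjoin ℂ s ?_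
      rw [hs]
      exact ⟨⟨n i, Submodule.subset_span ⟨i, rfl⟩⟩, rfl⟩
    exact fun f hf => h1 hf
  have : Algebra.IsIntegral (invariants Γ) (PolyFun V) :=
    Algebra.IsInvariant.isIntegral (invariants Γ) (PolyFun V) Γ
  have : Algebra.IsIntegral (Algebra.adjoin ℂ s) (PolyFun W) := ⟨fun t => by
    obtain ⟨f, rfl⟩ := restrictTo_surjective W t
    exact IsIntegral.map_of_comp_eq
      (((restrictTo W).comp (invariants Γ).val).codRestrict (Algebra.adjoin ℂ s)
        fun f => hmem f f.2).toRingHom (restrictTo W).toRingHom (RingHom.ext fun _ => rfl)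
      (Algebra.IsIntegral.isIntegral (R := invariants Γ) f)⟩
  have hdom : IsDomain (PolyFun W) :=
    (SymmetricAlgebra.equivMvPolynomial (finBasis ℂ (Dual ℂ W))).toMulEquiv.isDomain _
  have h1 : Algebra.trdeg ℂ (PolyFun W) ≤ Cardinal.mk s :=
    Algebra.IsAlgebraic.trdeg_le_cardinalMk ℂ s
  have h2 : Cardinal.mk s ≤ finrank ℂ (LinearMap.range L) := by
    have h3 := Cardinal.mk_range_le_lift (f := fun i => (b i : PolyFun W))
    simpa using h3
  rw [trdeg_polyFun] at h1
  exact_mod_cast h1.trans h2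

/-- A subspace of codimension at most one of a nonzero space contains a hyperplane. -/
lemma exists_isCoatom_le {E : Type*} [AddCommGroup E] [Module ℂ E] [FiniteDimensional ℂ E]
    (hE : 0 < finrank ℂ E) (F : Submodule ℂ E) (hF : finrank ℂ E ≤ finrank ℂ F + 1) :
    ∃ W, IsCoatom W ∧ W ≤ F := by
  have : Nontrivial E := Module.nontrivial_of_finrank_pos hE
  by_cases h : F = ⊤
  · obtain ⟨W, hW, _⟩ := (eq_top_or_exists_le_coatom (⊥ : Submodule ℂ E)).resolve_left bot_ne_top
    exact ⟨W, hW, h ▸ le_top⟩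
  · refine ⟨F, ⟨h, fun F' hlt => ?_⟩, le_rfl⟩
    have := Submodule.finrank_lt_finrank_of_lt hlt
    exact Submodule.eq_top_of_finrank_eq (le_antisymm (Submodule.finrank_le F') (by omega))

lemma finrank_of_isCoatom {W : Submodule ℂ V} (hW : IsCoatom W) :
    finrank ℂ V = finrank ℂ W + 1 := by
  obtain ⟨φ, hφ, rfl⟩ := exists_ker_eq_of_isCoatom hW
  exact (Module.Dual.finrank_ker_add_one_of_ne_zero hφ).symm

end Reflections

end ReflQuot

/-! ### The representation of the quotient group -/

namespace ReflQuot

open Module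

variable {V : Type*} [AddCommGroup V] [Module ℂ V]

section QuotientRepresentation

variable {G : Subgroup (LinearMap.GeneralLinearGroup ℂ V)} {κ : Type*} {n : κ → PolyFun V}

/-- The representation of `G` on the dual `E` of a stable space `E*` of polynomial functions. -/
noncomputable def dualRep (hst : ∀ (g : G), ∀ f ∈ spanOf n, g • f ∈ spanOf n) :
    G →* Module.End ℂ (Dual ℂ (spanOf n)) where
  toFun g := LinearMap.dualMap
    (((act ((g⁻¹ : G) : LinearMap.GeneralLinearGroup ℂ V)).toLinearMap).restrict (hst g⁻¹))
  map_one' := LinearMap.ext fun e => LinearMap.ext fun f => by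
    refine congrArg e (Subtype.ext ?_)
    change ((1 : G)⁻¹) • (f : PolyFun V) = f
    rw [inv_one, one_smul]
  map_mul' g h := LinearMap.ext fun e => LinearMap.ext fun f => by
    refine congrArg e (Subtype.ext ?_)
    change (g * h)⁻¹ • (f : PolyFun V) = h⁻¹ • g⁻¹ • (f : PolyFun V)
    rw [mul_inv_rev, mul_smul]

lemma dualRep_apply (hst : ∀ (g : G), ∀ f ∈ spanOf n, g • f ∈ spanOf n) (g : G)
    (e : Dual ℂ (spanOf n)) (f : spanOf n) :
    dualRep hst g e f = e ⟨g⁻¹ • (f : PolyFun V), hst g⁻¹ f f.2⟩ := rfl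

lemma dualRep_evalSpan (hst : ∀ (g : G), ∀ f ∈ spanOf n, g • f ∈ spanOf n) (g : G) (v : V) :
    dualRep hst g (evalSpan n v) = evalSpan n (g • v) := LinearMap.ext fun f => by
  rw [dualRep_apply, evalSpan_apply, evalSpan_apply]
  change evalAt v ((g⁻¹ : G) • (f : PolyFun V)) = _
  refine (evalAt_smul (g⁻¹ : LinearMap.GeneralLinearGroup ℂ V) v _).trans ?_
  rw [inv_inv]
  rfl

/-- The representation of `G/N` on `E`, when `N` fixes all the polynomial functions in `E*`. -/
noncomputable def quotientRep (hst : ∀ (g : G), ∀ f ∈ spanOf n, g • f ∈ spanOf n)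
    (N : Subgroup G) [N.Normal] (hfix : ∀ g ∈ N, ∀ f ∈ spanOf n, g • f = f) :
    G ⧸ N →* LinearMap.GeneralLinearGroup ℂ (Dual ℂ (spanOf n)) :=
  QuotientGroup.lift N (dualRep hst).toHomUnits fun g hg => Units.ext <|
    LinearMap.ext fun e => LinearMap.ext fun f => by
      refine congrArg e (Subtype.ext ?_)
      exact hfix _ (inv_mem hg) f f.2

lemma quotientRep_mk_smul (hst : ∀ (g : G), ∀ f ∈ spanOf n, g • f ∈ spanOf n)
    (N : Subgroup G) [N.Normal] (hfix : ∀ g ∈ N, ∀ f ∈ spanOf n, g • f = f) (g : G)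
    (e : Dual ℂ (spanOf n)) : quotientRep hst N hfix (g : G ⧸ N) • e = dualRep hst g e := rfl

/-- The images of reflections under the quotient representation are reflections: the fixed space
in `E` of the image of `g` contains the image of the reflecting hyperplane of `g`. -/
theorem IsReflection.quotientRep [FiniteDimensional ℂ V] [Finite κ]
    {Γ : Subgroup (LinearMap.GeneralLinearGroup ℂ V)} [Finite Γ]
    (hgen : Algebra.adjoin ℂ (Set.range n) = invariants Γ)
    (hdim : finrank ℂ (spanOf n) = finrank ℂ V)
    (hst : ∀ (g : G), ∀ f ∈ spanOf n, g • f ∈ spanOf n)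
    (N : Subgroup G) [N.Normal] (hfix : ∀ g ∈ N, ∀ f ∈ spanOf n, g • f = f) {g : G}
    (hg : IsReflection (g : LinearMap.GeneralLinearGroup ℂ V)) :
    IsReflection (quotientRep hst N hfix (g : G ⧸ N)) := by
  have : FiniteDimensional ℂ (spanOf n) := FiniteDimensional.span_of_finite ℂ (Set.finite_range n)
  obtain ⟨W, hW, hWg⟩ := hg
  have hWdim := finrank_of_isCoatom hW
  have hE : finrank ℂ (Dual ℂ (spanOf n)) = finrank ℂ V := by
    rw [Subspace.dual_finrank_eq, hdim]
  let F : Submodule ℂ (Dual ℂ (spanOf n)) := LinearMap.ker (dualRep hst g - 1)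
  have hF : finrank ℂ W ≤ finrank ℂ F := by
    refine finrank_le_of_evalSpan_mem hgen W F fun w hw => ?_
    have h1 : g • w = w := hWg w hw
    rw [LinearMap.mem_ker, LinearMap.sub_apply, dualRep_evalSpan, h1]
    exact sub_self _
  obtain ⟨W', hW', hle⟩ := exists_isCoatom_le (by omega) F (by omega)
  exact ⟨W', hW', fun e he => sub_eq_zero.1 (hle he)⟩

end QuotientRepresentation

lemma IsGeneratedByReflections.closure_eq_top
    {Γ : Subgroup (LinearMap.GeneralLinearGroup ℂ V)} (h : IsGeneratedByReflections Γ) :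
    Subgroup.closure {g : Γ | IsReflection (g : LinearMap.GeneralLinearGroup ℂ V)} = ⊤ := by
  rw [← top_le_iff, ← Subgroup.map_le_map_iff_of_injective Γ.subtype_injective,
    MonoidHom.map_closure, ← MonoidHom.range_eq_map, Γ.range_subtype]
  conv_lhs => rw [← h]
  exact Subgroup.closure_mono fun g hg => ⟨⟨g, hg.1⟩, hg.2, rfl⟩

end ReflQuot

theorem mainTheorem1 {V : Type*} [AddCommGroup V] [Module ℂ V] [FiniteDimensional ℂ V]
    (G : Subgroup (LinearMap.GeneralLinearGroup ℂ V))
    (hG : ReflQuot.IsComplexReflectionGroup G)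
    (N : Subgroup G) [N.Normal]
    (hN : ReflQuot.IsGeneratedByReflections (N.map G.subtype)) :
    -- fundamental `N`-invariants whose span `E*` is stable
    ∃ n : Fin (Module.finrank ℂ V) → ReflQuot.PolyFun V,
      ReflQuot.IsFundamentalInvariants (N.map G.subtype) n ∧
      ∃ stable : ∀ (g : G) (f : ReflQuot.spanOf n),
          ReflQuot.act (g : LinearMap.GeneralLinearGroup ℂ V) (f : ReflQuot.PolyFun V) ∈
            ReflQuot.spanOf n,
      -- the action of `H = G/N` on `E = (E*)*`, dual to its action `(gN) f = g f` on `E*`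
      ∃ ρ : G ⧸ N →*
          LinearMap.GeneralLinearGroup ℂ (Module.Dual ℂ (ReflQuot.spanOf n)),
        (∀ (g : G) (e : Module.Dual ℂ (ReflQuot.spanOf n)) (f : ReflQuot.spanOf n),
          (ρ (g : G ⧸ N) • e)
            ⟨ReflQuot.act (g : LinearMap.GeneralLinearGroup ℂ V) (f : ReflQuot.PolyFun V),
              stable g f⟩ = e f) ∧
        -- `H` acts on `E` as a complex reflection group
        Function.Injective ρ ∧
        ReflQuot.IsComplexReflectionGroup ρ.range ∧
        -- `E` is the orbit space `V/N`, compatibly with the action of `H`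
        ∃ Φ : MulAction.orbitRel.Quotient N V ≃ Module.Dual ℂ (ReflQuot.spanOf n),
          (∀ (v : V) (f : ReflQuot.spanOf n),
            Φ (Quotient.mk (MulAction.orbitRel N V) v) f =
              ReflQuot.evalAt v (f : ReflQuot.PolyFun V)) ∧
          (∀ (g : G) (v : V),
            Φ (Quotient.mk (MulAction.orbitRel N V) (g • v)) =
              ρ (g : G ⧸ N) • Φ (Quotient.mk (MulAction.orbitRel N V) v)) := by
  have hGfin : Finite G := hG.1
  have hΓfin : Finite (N.map G.subtype) := Finite.Set.finite_image _ _
  obtain ⟨n, hn, hst⟩ := ReflQuot.exists_isFundamentalInvariants_stable G N hN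
  have hfix : ∀ g ∈ N, ∀ f ∈ ReflQuot.spanOf n, g • f = f := fun g hg f hf =>
    ReflQuot.mem_invariants.1 (ReflQuot.spanOf_le_invariants hn.generate hf) g ⟨g, hg, rfl⟩
  -- The fibres of the evaluation map `V → E` are the orbits of `N`.
  have horbit : ∀ v w : V, ReflQuot.evalSpan n v = ReflQuot.evalSpan n w ↔
      ∃ g : N, g • w = v := by
    intro v w
    constructor
    · intro h
      obtain ⟨⟨_, g, hg, rfl⟩, hgv⟩ := ReflQuot.exists_smul_eq_of_evalSpan_eq hn.generate h.symm
      exact ⟨⟨g, hg⟩, hgv⟩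
    · rintro ⟨g, rfl⟩
      refine LinearMap.ext fun f => ?_
      rw [ReflQuot.evalSpan_apply, ReflQuot.evalSpan_apply]
      have h1 := ReflQuot.evalAt_smul ((g⁻¹ : G) : LinearMap.GeneralLinearGroup ℂ V) w
        (f : ReflQuot.PolyFun V)
      have h2 : ((g⁻¹ : G) : LinearMap.GeneralLinearGroup ℂ V) • (f : ReflQuot.PolyFun V) = f :=
        hfix _ (inv_mem g.2) f f.2
      rw [h2] at h1
      rw [h1, Subgroup.coe_inv, inv_inv]
      rfl
  refine ⟨n, hn, fun g f => hst g f f.2, ReflQuot.quotientRep hst N hfix, ?_, ?_, ?_, ?_⟩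
  · intro g e f
    rw [ReflQuot.quotientRep_mk_smul, ReflQuot.dualRep_apply]
    refine congrArg e (Subtype.ext ?_)
    exact inv_smul_smul g (f : ReflQuot.PolyFun V)
  · rw [injective_iff_map_eq_one]
    intro x hx
    induction x using QuotientGroup.induction_on with
    | H g =>
      rw [QuotientGroup.eq_one_iff]
      have hmem : (g : LinearMap.GeneralLinearGroup ℂ V) ∈ N.map G.subtype := by
        refine ReflQuot.mem_of_forall_exists_smul_eq fun v => ?_
        have h1 : ReflQuot.evalSpan n (g • v) = ReflQuot.evalSpan n v := by
          rw [← ReflQuot.dualRep_evalSpan hst, ← ReflQuot.quotientRep_mk_smul hst N hfix, hx,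
            one_smul]
        obtain ⟨x, hx⟩ := (horbit _ _).1 h1
        exact ⟨⟨_, x, x.2, rfl⟩, hx⟩
      obtain ⟨g', hg', hgg'⟩ := hmem
      rwa [← G.subtype_injective hgg']
  · refine ⟨Finite.Set.finite_range _, le_antisymm ?_ ?_⟩
    · rw [Subgroup.closure_le]
      exact fun g hg => hg.1
    · -- It suffices that the images of the reflections in `G` are reflections.
      have hdim : Module.finrank ℂ (ReflQuot.spanOf n) = Module.finrank ℂ V := by
        rw [finrank_span_eq_card hn.algebraicIndependent.linearIndependent, Fintype.card_fin]
      rw [MonoidHom.range_eq_map, ← Subgroup.map_top_of_surjective (QuotientGroup.mk' N)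
        (QuotientGroup.mk'_surjective N), ← hG.2.closure_eq_top, MonoidHom.map_closure,
        MonoidHom.map_closure]
      refine Subgroup.closure_mono ?_
      rintro _ ⟨_, ⟨g, hg, rfl⟩, rfl⟩
      exact ⟨Subgroup.subset_closure ⟨_, ⟨g, hg, rfl⟩, rfl⟩,
        ReflQuot.IsReflection.quotientRep hn.generate hdim hst N hfix hg⟩
  · let Φ₀ : MulAction.orbitRel.Quotient N V → Module.Dual ℂ (ReflQuot.spanOf n) :=
      Quotient.lift (ReflQuot.evalSpan n) fun v w h => (horbit v w).2 h
    have hΦ₀ : Function.Bijective Φ₀ := by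
      constructor
      · rintro ⟨v⟩ ⟨w⟩ h
        exact Quotient.sound ((horbit v w).1 h)
      · intro e
        obtain ⟨v, hv⟩ := ReflQuot.evalSpan_surjective hn.algebraicIndependent hn.generate e
        exact ⟨Quotient.mk _ v, hv⟩
    refine ⟨Equiv.ofBijective Φ₀ hΦ₀, fun v f => rfl, fun g v => ?_⟩
    rw [ReflQuot.quotientRep_mk_smul]
    exact (ReflQuot.dualRep_evalSpan hst g v).symm
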